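/- **Theorem (Closed form of $\mathcal B$).** Let $\mathcal M_+(S^1)$ denote the set of nonzero finite non-negative Borel measures on the unit circle $S^1\subset\mathbb C$. For $\lambda\in\mathcal M_+(S^1)$, $\sigma\in\mathbb R$ and $|z|<1$ put $$Q[\lambda](z)=\int \frac{1+e^{-i\theta}z}{1-e^{-i\theta}z}\,d\lambda(\theta),\qquad Q_\sigma[\lambda](z)=Q[\lambda](z)+i\sigma,\qquad H[\lambda](e^{i\theta})=\lim_{r\to1^-}\operatorname{Im}Q[\lambda](re^{i\theta}),$$ the last at those points where the limit exists; below, "$H[\lambda](z)+c_0=0$" means that the limit exists at $z$ and equals $-c_0$. Write $\mathcal B[\lambda,c_0]=(\mu,\zeta_0)$ if $\mu\in\mathcal M_+(S^1)$, $\zeta_0\in\mathbb R$ and $Q_{c_0}[\lambda](z)\,Q_{\zeta_0}[\mu](z)=1$ for all $|z|<1$. Let $$N_0(\lambda)=\bigcap_{\varepsilon>0}\operatorname{clos}\Big\{e^{i\theta}\;\Big|\;\limsup_{\delta\to0^+}\frac{\lambda(\exp i[\theta-\delta,\theta+\delta])}{2\delta}<\varepsilon\Big\},$$ let $\operatorname{supp}\lambda$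 be the closed support of $\lambda$, let $\|\lambda\|=\lambda(S^1)$, and let $\lambda_c\in L^1(S^1)$ be the density of the absolutely continuous part of $\lambda$ with respect to the normalized Lebesgue measure $(2\pi)^{-1}d\theta$. Let $\lambda\in\mathcal M_+(S^1)$ and $c_0\in\mathbb R$, and assume that $$Z'=\big(N_0(\lambda)\cap\operatorname{supp}\lambda\big)\cup\{z\in S^1\setminus\operatorname{supp}\lambda\mid H[\lambda](z)+c_0=0\}$$ is discrete: for every $z\in Z'$ there is $\varepsilon>0$ such that $|z-z'|>\varepsilon$ for all $z'\in Z'$ with $z'\neq z$. Then there is exactly one pair $(\mu,\zeta_0)$ with $\mathcal B[\lambda,c_0]=(\mu,\zeta_0)$; the limit defining $H[\lambda]$ exists almost everywhere; and $$d\mu(\theta)=(2\pi)^{-1}\mu_c(e^{i\theta})\,d\theta+\sum_{\alpha\in Z}\beta_\alpha\,d\delta_\alpha(\theta),$$ where $\delta_\alpha$ is the unit point mass at $\alpha$, $$\mu_c=\frac{\lambda_c}{\lambda_c^2+(H[\lambda]+c_0)^2}\in L^1(S^1),\qquad Z=N_0(\lambda)\cap\{z\in S^1\mid H[\lambda](z)+c_0=0\}\subset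 Z',$$ and, for $\alpha=e^{i\theta_\alpha}\in Z$, $$\beta_\alpha=\left(\int\frac{d\lambda(\theta)}{\sin^2[(\theta-\theta_\alpha)/2]}\right)^{-1},$$ the integral being taken in $[0,\infty]$ with $1/0=\infty$ and $1/\infty=0$ (so $\beta_\alpha=0$ where it diverges). Finally, $$\zeta_0=\operatorname{Im}\big[(\|\lambda\|+ic_0)^{-1}\big].$$ -/

import Mathlib

open MeasureTheory Filter Topology Set

/-- The unit circle `S¹ ⊆ ℂ` carries its Borel σ-algebra. -/
noncomputable instance instMeasurableSpaceUnitCircle : MeasurableSpace Circle := borel Circle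

instance instBorelSpaceUnitCircle : BorelSpace Circle := ⟨rfl⟩

namespace CircleInterconversion

noncomputable section

/-- The normalized Lebesgue measure `(2π)⁻¹ dθ` on the circle: the image under `θ ↦ e^{iθ}` of
`(2π)⁻¹` times Lebesgue measure on `(-π, π]`. -/
def normalizedLebesgue : Measure Circle :=
  Measure.map Circle.exp
    ((ENNReal.ofReal (2 * Real.pi))⁻¹ •
      (volume : Measure ℝ).restrict (Ioc (-Real.pi) Real.pi))

/-- The Cauchy transform `Q[lam](z) = ∫ (1 + e^{-iθ} z) / (1 - e^{-iθ} z) d lam(θ)`, used for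
`|z| < 1`. -/
def cauchyTransform (lam : Measure Circle) (z : ℂ) : ℂ :=
  ∫ w : Circle, (1 + ((w⁻¹ : Circle) : ℂ) * z) / (1 - ((w⁻¹ : Circle) : ℂ) * z) ∂lam

/-- The shifted Cauchy transform `Q_σ[lam](z) = Q[lam](z) + i σ`. -/
def shiftedCauchyTransform (lam : Measure Circle) (σ : ℝ) (z : ℂ) : ℂ :=
  cauchyTransform lam z + Complex.I * (σ : ℂ)

/-- The Hilbert transform of `lam` exists at the point `z` of the circle and has the value `h`:
`Im Q[lam](r z) → h` as `r → 1`, `r < 1`. -/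
def HasHilbertTransformAt (lam : Measure Circle) (z : Circle) (h : ℝ) : Prop :=
  Tendsto (fun r : ℝ => (cauchyTransform lam ((r : ℂ) * (z : ℂ))).im) (𝓝[<] 1) (𝓝 h)

/-- The Hilbert transform `H[lam](z) = lim_{r → 1} Im Q[lam](r z)`, meaningful at the points where
the limit exists. -/
def hilbertTransform (lam : Measure Circle) (z : Circle) : ℝ :=
  limUnder (𝓝[<] (1 : ℝ)) (fun r : ℝ => (cauchyTransform lam ((r : ℂ) * (z : ℂ))).im)

/-- `𝓑[lam, c₀] = (mu, ζ₀)`: `mu` is a nonzero finite positive Borel measure on the circle, and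
`Q_{c₀}[lam] Q_{ζ₀}[mu] ≡ 1` on the open unit disc. -/
structure IsInterconversion (lam : Measure Circle) (c₀ : ℝ) (mu : Measure Circle) (ζ₀ : ℝ) :
    Prop where
  finite : IsFiniteMeasure mu
  ne_zero : mu ≠ 0
  mul_eq_one : ∀ z : ℂ, ‖z‖ < 1 →
    shiftedCauchyTransform lam c₀ z * shiftedCauchyTransform mu ζ₀ z = 1

/-- The zero set `N₀(lam)`: the intersection over `ε > 0` of the closures of
`{e^{iθ} | limsup_{δ → 0} lam(exp i[θ - δ, θ + δ]) / 2δ < ε}`. -/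
def zeroSet (lam : Measure Circle) : Set Circle :=
  ⋂ (ε : ℝ) (_ : 0 < ε), closure (Circle.exp '' {θ : ℝ |
    limsup (fun δ : ℝ => lam (Circle.exp '' Icc (θ - δ) (θ + δ)) / ENNReal.ofReal (2 * δ))
      (𝓝[>] 0) < ENNReal.ofReal ε})

/-- The set `Z' = (N₀(lam) ∩ supp lam) ∪ {z ∉ supp lam | H[lam](z) + c₀ = 0}`. -/
def candidateSet (lam : Measure Circle) (c₀ : ℝ) : Set Circle :=
  (zeroSet lam ∩ lam.support) ∪ {z | z ∉ lam.support ∧ HasHilbertTransformAt lam z (-c₀)}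

/-- The set `Z = N₀(lam) ∩ {z | H[lam](z) + c₀ = 0}`. -/
def atomSet (lam : Measure Circle) (c₀ : ℝ) : Set Circle :=
  zeroSet lam ∩ {z | HasHilbertTransformAt lam z (-c₀)}

/-- The density `lam_c` of the absolutely continuous part of `lam` with respect to the normalized
Lebesgue measure. -/
def contDensity (lam : Measure Circle) (z : Circle) : ℝ :=
  (lam.rnDeriv normalizedLebesgue z).toReal

/-- The function `lam_c / (lam_c² + (H[lam] + c₀)²)`. -/
def interconvertedDensity (lam : Measure Circle) (c₀ : ℝ) (z : Circle) : ℝ :=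
  contDensity lam z / (contDensity lam z ^ 2 + (hilbertTransform lam z + c₀) ^ 2)

/-- The weight `(∫ d lam(θ) / sin²((θ - θ₀) / 2))⁻¹` at `z = e^{iθ₀}`, with values in `[0, ∞]`,
where `1 / 0 = ∞` and `1 / ∞ = 0`. -/
def atomWeight (lam : Measure Circle) (z : Circle) : ENNReal :=
  (∫⁻ w : Circle, (ENNReal.ofReal
    (Real.sin ((Complex.arg (w : ℂ) - Complex.arg (z : ℂ)) / 2) ^ 2))⁻¹ ∂lam)⁻¹

end

end CircleInterconversion

namespace CircleInterconversion

noncomputable section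

/-! The function `Q_{c₀}[lam]` is holomorphic on the disc with positive real part, hence so is its
reciprocal. The Herglotz representation (`exists_shiftedCauchyTransform_eq`) writes the reciprocal
as `Q_{ζ₀}[mu]`. The pair is unique because a Cauchy transform determines all moments of its measure
(`measure_eq_of_shiftedCauchyTransform_eq`). The value at `z = 0` gives `ζ₀`.

Absolutely continuous part: almost everywhere both functions have finite radial limits whose product
is 1, so the limit `l` of `Q_{c₀}[lam]` is nonzero. By Fatou's theorem the density of `mu` is `Re
(1/l) = Re l / |l|²`, with `Re l = lam_c` and `Im l = H[lam] + c₀`.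

Singular part: at almost every point for the singular part of `mu`, `Re Q[mu] → ∞` radially, so
`Q_{c₀}[lam] → 0` and the point lies in `Z` (`ae_mem_atomSet`). Discreteness of `Z'` serves only to
make `Z` countable, which forces the singular part to be a sum of atoms.

Masses (`apply_singleton`): `(1 - r)/2 · Re Q[mu](rα) → mu {α}`. If `J = ∫ |w - α|⁻² dlam` is
finite, then `Q_{c₀}[lam](rα) / (1 - r) → 2J`, so the mass is `1/(4J)`; this is the stated weight,
since the chord is `2 |sin|` of half the angle. If the integral diverges, a positive mass would make
`Re Q[lam](rα)` at most a multiple of `1 - r`, and Fatou's lemma would then give convergence. -/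

/-! ### The Cauchy kernel: holomorphy and positivity of the real part -/

lemma norm_inv_mul (w : Circle) (z : ℂ) : ‖((w⁻¹ : Circle) : ℂ) * z‖ = ‖z‖ := by
  rw [norm_mul, Circle.norm_coe, one_mul]

lemma one_sub_norm_le (w : Circle) (z : ℂ) : 1 - ‖z‖ ≤ ‖1 - ((w⁻¹ : Circle) : ℂ) * z‖ := by
  have := norm_sub_norm_le 1 (((w⁻¹ : Circle) : ℂ) * z)
  rwa [norm_inv_mul, norm_one] at this

lemma one_sub_ne_zero (w : Circle) {z : ℂ} (hz : ‖z‖ < 1) : 1 - ((w⁻¹ : Circle) : ℂ) * z ≠ 0 := by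
  rw [← norm_pos_iff]
  linarith [one_sub_norm_le w z]

lemma norm_one_sub_eq (w : Circle) (z : ℂ) : ‖1 - ((w⁻¹ : Circle) : ℂ) * z‖ = ‖(w : ℂ) - z‖ := by
  have h : (w : ℂ) - z = w * (1 - ((w⁻¹ : Circle) : ℂ) * z) := by
    rw [Circle.coe_inv]
    field_simp [Circle.coe_ne_zero w]
  rw [h, norm_mul, Circle.norm_coe, one_mul]

lemma continuous_inv_mul (z : ℂ) : Continuous fun w : Circle => ((w⁻¹ : Circle) : ℂ) * z := by
  fun_prop

lemma integrable_of_continuous (lam : Measure Circle) [IsFiniteMeasure lam] {E : Type*}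
    [NormedAddCommGroup E] {f : Circle → E} (hf : Continuous f) : Integrable f lam :=
  hf.integrable_of_hasCompactSupport (HasCompactSupport.of_compactSpace f)

lemma continuous_kernel {z : ℂ} (hz : ‖z‖ < 1) : Continuous fun w : Circle =>
    (1 + ((w⁻¹ : Circle) : ℂ) * z) / (1 - ((w⁻¹ : Circle) : ℂ) * z) :=
  (continuous_const.add (continuous_inv_mul z)).div₀ (continuous_const.sub (continuous_inv_mul z))
    fun w => one_sub_ne_zero w hz

/-- Cauchy-type integrals of continuous densities are holomorphic in the disc. -/
lemma differentiableOn_cauchyIntegral (lam : Measure Circle) [IsFiniteMeasure lam] {φ : Circle → ℂ}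
    (hφ : Continuous φ) :
    DifferentiableOn ℂ (fun z : ℂ => ∫ w, φ w / (1 - ((w⁻¹ : Circle) : ℂ) * z) ∂lam)
      (Metric.ball 0 1) := by
  intro z₀ hz₀
  rw [mem_ball_zero_iff] at hz₀
  -- On the ball of radius `ρ < 1` the denominators stay at least `1 - ρ`, which bounds the
  -- `z`-derivative of the integrand uniformly.
  obtain ⟨ρ, h1, h2⟩ := exists_between hz₀
  have hcont : ∀ z : ℂ, ‖z‖ < 1 →
      Continuous fun w : Circle => φ w / (1 - ((w⁻¹ : Circle) : ℂ) * z) := fun z hz =>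
    hφ.div₀ (continuous_const.sub (continuous_inv_mul z)) fun w => one_sub_ne_zero w hz
  obtain ⟨C, hC⟩ := isCompact_univ.exists_bound_of_continuousOn hφ.continuousOn
  have hball : Metric.ball (0 : ℂ) ρ ∈ 𝓝 z₀ :=
    Metric.isOpen_ball.mem_nhds (by rwa [mem_ball_zero_iff])
  have key := hasDerivAt_integral_of_dominated_loc_of_deriv_le (μ := lam) (𝕜 := ℂ)
    (F := fun z w => φ w / (1 - ((w⁻¹ : Circle) : ℂ) * z))
    (F' := fun z w => φ w * ((w⁻¹ : Circle) : ℂ) / (1 - ((w⁻¹ : Circle) : ℂ) * z) ^ 2)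
    (bound := fun _ => C / (1 - ρ) ^ 2) hball ?_ (integrable_of_continuous lam (hcont z₀ hz₀)) ?_ ?_
    (integrable_const _) ?_
  · exact key.2.differentiableAt.differentiableWithinAt
  · filter_upwards [hball] with z hz
    rw [mem_ball_zero_iff] at hz
    exact (hcont z (hz.trans h2)).aestronglyMeasurable
  · refine Continuous.aestronglyMeasurable ?_
    exact Continuous.div₀ (by fun_prop) (by fun_prop) fun w =>
      pow_ne_zero 2 (one_sub_ne_zero w hz₀)
  · refine ae_of_all _ fun w z hz => ?_
    rw [mem_ball_zero_iff] at hz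
    rw [norm_div, norm_mul, Circle.norm_coe, mul_one, norm_pow]
    have h3 := one_sub_norm_le w z
    have h4 := hC w (mem_univ w)
    have : 0 ≤ C := (norm_nonneg _).trans h4
    have : 0 < 1 - ρ := by linarith
    gcongr
    linarith
  · refine ae_of_all _ fun w z hz => ?_
    rw [mem_ball_zero_iff] at hz
    have h3 := one_sub_ne_zero w (hz.trans h2)
    have h4 : HasDerivAt (fun z : ℂ => 1 - ((w⁻¹ : Circle) : ℂ) * z) (-((w⁻¹ : Circle) : ℂ)) z := by
      simpa using ((hasDerivAt_id z).const_mul ((w⁻¹ : Circle) : ℂ)).const_sub 1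
    simpa using (hasDerivAt_const z (φ w)).fun_div h4 h3

lemma cauchyTransform_eq (lam : Measure Circle) [IsFiniteMeasure lam] {z : ℂ} (hz : ‖z‖ < 1) :
    cauchyTransform lam z =
      2 * ∫ w, 1 / (1 - ((w⁻¹ : Circle) : ℂ) * z) ∂lam - (lam.real univ : ℂ) := by
  have hc : Continuous fun w : Circle => 1 / (1 - ((w⁻¹ : Circle) : ℂ) * z) :=
    continuous_const.div₀ (continuous_const.sub (continuous_inv_mul z))
      fun w => one_sub_ne_zero w hz
  have : (lam.real univ : ℂ) = ∫ _w : Circle, (1 : ℂ) ∂lam := by simp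
  rw [this, ← integral_const_mul, ← integral_sub
    ((integrable_of_continuous lam hc).const_mul 2) (integrable_const _)]
  refine integral_congr_ae (ae_of_all _ fun w => ?_)
  have h3 := one_sub_ne_zero w hz
  simp only
  generalize ((w⁻¹ : Circle) : ℂ) * z = u at h3 ⊢
  field_simp
  ring

lemma differentiableOn_cauchyTransform (lam : Measure Circle) [IsFiniteMeasure lam] :
    DifferentiableOn ℂ (cauchyTransform lam) (Metric.ball 0 1) := by
  refine (((differentiableOn_cauchyIntegral lam
    (continuous_const (y := (1 : ℂ)))).const_mul 2).sub_const (lam.real univ : ℂ)).congr ?_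
  intro z hz
  rw [mem_ball_zero_iff] at hz
  exact cauchyTransform_eq lam hz

lemma cauchyTransform_zero (lam : Measure Circle) [IsFiniteMeasure lam] :
    cauchyTransform lam 0 = (lam.real univ : ℂ) := by
  simp [cauchyTransform]

lemma re_kernel (w : Circle) {z : ℂ} (hz : ‖z‖ < 1) :
    ((1 + ((w⁻¹ : Circle) : ℂ) * z) / (1 - ((w⁻¹ : Circle) : ℂ) * z)).re =
      (1 - ‖z‖ ^ 2) / ‖(w : ℂ) - z‖ ^ 2 := by
  rw [← norm_one_sub_eq]
  have h3 := one_sub_ne_zero w hz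
  have h4 := norm_inv_mul w z
  set u := ((w⁻¹ : Circle) : ℂ) * z
  rw [← h4, Complex.div_re, ← Complex.normSq_eq_norm_sq, ← Complex.normSq_eq_norm_sq]
  have : Complex.normSq (1 - u) ≠ 0 := by simpa using h3
  field_simp
  simp [Complex.normSq_apply]
  ring

lemma re_cauchyTransform (lam : Measure Circle) [IsFiniteMeasure lam] {z : ℂ} (hz : ‖z‖ < 1) :
    (cauchyTransform lam z).re = ∫ w : Circle, (1 - ‖z‖ ^ 2) / ‖(w : ℂ) - z‖ ^ 2 ∂lam := by
  rw [cauchyTransform, ← Complex.reCLM_apply, ← Complex.reCLM.integral_comp_comm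
    (integrable_of_continuous lam (continuous_kernel hz))]
  exact integral_congr_ae (ae_of_all _ fun w => re_kernel w hz)

lemma continuous_poisson {z : ℂ} (hz : ‖z‖ < 1) :
    Continuous fun w : Circle => (1 - ‖z‖ ^ 2) / ‖(w : ℂ) - z‖ ^ 2 := by
  refine Continuous.div₀ (by fun_prop) (by fun_prop) fun w => ?_
  rw [← norm_one_sub_eq]
  exact pow_ne_zero 2 (norm_ne_zero_iff.2 (one_sub_ne_zero w hz))

lemma poisson_pos (w : Circle) {z : ℂ} (hz : ‖z‖ < 1) :
    0 < (1 - ‖z‖ ^ 2) / ‖(w : ℂ) - z‖ ^ 2 := by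
  rw [← norm_one_sub_eq]
  have := norm_pos_iff.2 (one_sub_ne_zero w hz)
  have : 0 < 1 - ‖z‖ ^ 2 := by nlinarith [norm_nonneg z]
  positivity

lemma re_cauchyTransform_pos (lam : Measure Circle) [IsFiniteMeasure lam] (hlam : lam ≠ 0) {z : ℂ}
    (hz : ‖z‖ < 1) : 0 < (cauchyTransform lam z).re := by
  rw [re_cauchyTransform lam hz, integral_pos_iff_support_of_nonneg
    (fun w => (poisson_pos w hz).le) (integrable_of_continuous lam (continuous_poisson hz))]
  have : Function.support (fun w : Circle => (1 - ‖z‖ ^ 2) / ‖(w : ℂ) - z‖ ^ 2) = univ :=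
    eq_univ_of_forall fun w => (poisson_pos w hz).ne'
  rw [this]
  exact Measure.measure_univ_pos.2 hlam

lemma re_cauchyTransform_nonneg (lam : Measure Circle) [IsFiniteMeasure lam] {z : ℂ}
    (hz : ‖z‖ < 1) : 0 ≤ (cauchyTransform lam z).re := by
  rw [re_cauchyTransform lam hz]
  exact integral_nonneg fun w => (poisson_pos w hz).le

/-! ### Uniqueness of the representing measure -/

/-- Each step divides the integral minus its value at 0 by `z`: with `a = w⁻¹`, `z aⁿ⁺¹/(1 - az) =
aⁿ/(1 - az) - aⁿ`. Setting `z = 0` in the conclusion yields equality of the `n`-th moments. -/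
lemma moments_eq_of_cauchyIntegral_eq {mu nu : Measure Circle} [IsFiniteMeasure mu]
    [IsFiniteMeasure nu] (h : ∀ z : ℂ, ‖z‖ < 1 →
      ∫ w, 1 / (1 - ((w⁻¹ : Circle) : ℂ) * z) ∂mu = ∫ w, 1 / (1 - ((w⁻¹ : Circle) : ℂ) * z) ∂nu)
    (n : ℕ) : ∀ z : ℂ, ‖z‖ < 1 →
      ∫ w, ((w⁻¹ : Circle) : ℂ) ^ n / (1 - ((w⁻¹ : Circle) : ℂ) * z) ∂mu =
        ∫ w, ((w⁻¹ : Circle) : ℂ) ^ n / (1 - ((w⁻¹ : Circle) : ℂ) * z) ∂nu := by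
  induction n with
  | zero => simpa using h
  | succ n ih =>
    have hstep : ∀ (lam : Measure Circle) [IsFiniteMeasure lam] (z : ℂ), ‖z‖ < 1 →
        z * ∫ w, ((w⁻¹ : Circle) : ℂ) ^ (n + 1) / (1 - ((w⁻¹ : Circle) : ℂ) * z) ∂lam =
          (∫ w, ((w⁻¹ : Circle) : ℂ) ^ n / (1 - ((w⁻¹ : Circle) : ℂ) * z) ∂lam) -
            ∫ w, ((w⁻¹ : Circle) : ℂ) ^ n / (1 - ((w⁻¹ : Circle) : ℂ) * 0) ∂lam := by
      intro lam _ z hz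
      have hc : ∀ z : ℂ, ‖z‖ < 1 → Continuous fun w : Circle =>
          ((w⁻¹ : Circle) : ℂ) ^ n / (1 - ((w⁻¹ : Circle) : ℂ) * z) := fun z hz =>
        Continuous.div₀ (by fun_prop) (by fun_prop) fun w => one_sub_ne_zero w hz
      rw [← integral_const_mul, ← integral_sub (integrable_of_continuous lam (hc z hz))
        (integrable_of_continuous lam (hc 0 (by simp)))]
      refine integral_congr_ae (ae_of_all _ fun w => ?_)
      have h3 := one_sub_ne_zero w hz
      simp only [mul_zero, sub_zero, div_one]
      generalize ((w⁻¹ : Circle) : ℂ) = a at h3 ⊢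
      rw [mul_comm] at h3
      field_simp
      ring
    have hne : ∀ z : ℂ, ‖z‖ < 1 → z ≠ 0 →
        ∫ w, ((w⁻¹ : Circle) : ℂ) ^ (n + 1) / (1 - ((w⁻¹ : Circle) : ℂ) * z) ∂mu =
        ∫ w, ((w⁻¹ : Circle) : ℂ) ^ (n + 1) / (1 - ((w⁻¹ : Circle) : ℂ) * z) ∂nu := by
      intro z hz hz0
      refine mul_left_cancel₀ hz0 ?_
      rw [hstep mu z hz, hstep nu z hz, ih z hz, ih 0 (by simp)]
    intro z hz
    -- Division by `z` loses the point 0; continuity there recovers it.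
    rcases eq_or_ne z 0 with rfl | hz0
    · have hca : ∀ (lam : Measure Circle) [IsFiniteMeasure lam], Tendsto (fun z : ℂ =>
          ∫ w, ((w⁻¹ : Circle) : ℂ) ^ (n + 1) / (1 - ((w⁻¹ : Circle) : ℂ) * z) ∂lam) (𝓝[≠] 0)
          (𝓝 (∫ w, ((w⁻¹ : Circle) : ℂ) ^ (n + 1) / (1 - ((w⁻¹ : Circle) : ℂ) * 0) ∂lam)) := by
        intro lam _
        have := (differentiableOn_cauchyIntegral lam
          (φ := fun w => ((w⁻¹ : Circle) : ℂ) ^ (n + 1)) (by fun_prop)).continuousOn.continuousAt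
            (Metric.ball_mem_nhds (0 : ℂ) one_pos)
        exact this.tendsto.mono_left nhdsWithin_le_nhds
      refine tendsto_nhds_unique (hca mu) ((hca nu).congr' ?_)
      filter_upwards [self_mem_nhdsWithin,
        nhdsWithin_le_nhds (Metric.ball_mem_nhds (0 : ℂ) one_pos)]
        with z hz0 hz
      rw [mem_ball_zero_iff] at hz
      exact (hne z hz hz0).symm
    · exact hne z hz hz0

/-- The character `w ↦ w ^ n` of the circle. -/
def circlePow (n : ℤ) : BoundedContinuousFunction Circle ℂ :=
  BoundedContinuousFunction.mkOfCompact
    ⟨fun w : Circle => ((w ^ n : Circle) : ℂ), continuous_induced_dom.comp (continuous_zpow n)⟩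

lemma circlePow_apply (n : ℤ) (w : Circle) : circlePow n w = ((w ^ n : Circle) : ℂ) := rfl

/-- The star subalgebra of Laurent polynomials on the circle. -/
def laurentSubalgebra : StarSubalgebra ℂ (BoundedContinuousFunction Circle ℂ) where
  toSubalgebra := Algebra.adjoin ℂ (range circlePow)
  star_mem' := by
    change Algebra.adjoin ℂ (range circlePow) ≤ star (Algebra.adjoin ℂ (range circlePow))
    refine Algebra.adjoin_le ?_
    rintro _ ⟨n, rfl⟩
    refine Algebra.subset_adjoin ⟨-n, ?_⟩
    ext w
    simp [circlePow_apply, ← Circle.coe_inv_eq_conj, zpow_neg]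

/-- The characters are closed under multiplication, so the algebra they generate is just their
linear span, and integrals need comparing on characters only. -/
lemma laurentSubalgebra_coe :
    Subalgebra.toSubmodule laurentSubalgebra.toSubalgebra = Submodule.span ℂ (range circlePow) := by
  refine Algebra.adjoin_eq_span_of_subset _ (Subset.trans ?_ Submodule.subset_span)
  intro x hx
  refine Submonoid.closure_induction (fun _ => id) ⟨0, ?_⟩ ?_ hx
  · ext w
    simp [circlePow_apply]
  · rintro _ _ _ _ ⟨m, rfl⟩ ⟨n, rfl⟩
    refine ⟨m + n, ?_⟩
    ext w
    simp [circlePow_apply, zpow_add]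

/-- A Stone–Weierstrass argument: the Laurent polynomials form a star subalgebra in which the
character of degree 1 already separates points. -/
lemma measure_eq_of_moments {mu nu : Measure Circle} [IsFiniteMeasure mu] [IsFiniteMeasure nu]
    (h : ∀ n : ℤ, ∫ w, ((w ^ n : Circle) : ℂ) ∂mu = ∫ w, ((w ^ n : Circle) : ℂ) ∂nu) : mu = nu := by
  refine ext_of_forall_mem_subalgebra_integral_eq_of_polish (A := laurentSubalgebra) ?_ ?_
  · intro x y hxy
    refine ⟨_, ⟨_, ⟨circlePow 1, Algebra.subset_adjoin ⟨1, rfl⟩, rfl⟩, rfl⟩, ?_⟩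
    change circlePow 1 x ≠ circlePow 1 y
    simpa [circlePow_apply, Circle.coe_inj] using hxy
  · intro g hg₀
    have hg' : g ∈ Submodule.span ℂ (range circlePow) := by
      rw [← laurentSubalgebra_coe]
      exact hg₀
    clear hg₀
    induction hg' using Submodule.span_induction with
    | mem g hg => obtain ⟨n, rfl⟩ := hg; exact h n
    | zero => simp
    | add f g _ _ hf hg =>
      simp only [BoundedContinuousFunction.coe_add, Pi.add_apply]
      rw [integral_add (f.integrable mu) (g.integrable mu),
        integral_add (f.integrable nu) (g.integrable nu), hf, hg]
    | smul a f _ hf =>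
      simp only [BoundedContinuousFunction.coe_smul, integral_smul, hf]

/-- A finite measure is determined by its Cauchy transform up to an additive constant. -/
lemma measure_eq_of_shiftedCauchyTransform_eq {mu nu : Measure Circle} [IsFiniteMeasure mu]
    [IsFiniteMeasure nu] {s t : ℝ}
    (h : ∀ z : ℂ, ‖z‖ < 1 → shiftedCauchyTransform mu s z = shiftedCauchyTransform nu t z) :
    mu = nu ∧ s = t := by
  have h0 := h 0 (by simp)
  simp only [shiftedCauchyTransform, cauchyTransform_zero] at h0
  have hst : s = t := by simpa using congrArg Complex.im h0
  have hmass : mu.real univ = nu.real univ := by simpa using congrArg Complex.re h0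
  refine ⟨?_, hst⟩
  have hm := moments_eq_of_cauchyIntegral_eq (mu := mu) (nu := nu) fun z hz => by
    have h1 := h z hz
    rw [shiftedCauchyTransform, shiftedCauchyTransform, hst, cauchyTransform_eq mu hz,
      cauchyTransform_eq nu hz, hmass] at h1
    exact mul_left_cancel₀ two_ne_zero (sub_left_injective (add_left_injective _ h1))
  have hneg : ∀ n : ℕ, ∫ w, ((w ^ (-(n : ℤ)) : Circle) : ℂ) ∂mu =
      ∫ w, ((w ^ (-(n : ℤ)) : Circle) : ℂ) ∂nu := fun n => by
    simpa using hm n 0 (by simp)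
  -- The Cauchy integral sees only powers of `w⁻¹`; the opposite powers follow by conjugation
  -- because the measures are positive.
  have hpos : ∀ n : ℕ, ∫ w, ((w ^ (n : ℤ) : Circle) : ℂ) ∂mu =
      ∫ w, ((w ^ (n : ℤ) : Circle) : ℂ) ∂nu := fun n => by
    have h1 := congrArg (starRingEnd ℂ) (hneg n)
    rw [← integral_conj, ← integral_conj] at h1
    simpa [← Circle.coe_inv_eq_conj] using h1
  refine measure_eq_of_moments fun n => ?_
  obtain ⟨n, rfl | rfl⟩ := n.eq_nat_or_neg
  · exact hpos n
  · exact hneg n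

/-! ### The Herglotz representation -/

instance : IsProbabilityMeasure normalizedLebesgue := by
  constructor
  rw [normalizedLebesgue, Measure.map_apply (by fun_prop) MeasurableSet.univ, preimage_univ,
    Measure.smul_apply, Measure.restrict_apply_univ, Real.volume_Ioc, sub_neg_eq_add, ← two_mul,
    smul_eq_mul]
  exact ENNReal.inv_mul_cancel (by simp [Real.pi_pos]) ENNReal.ofReal_ne_top

lemma integral_normalizedLebesgue {E : Type*} [NormedAddCommGroup E] [NormedSpace ℝ E]
    {g : ℂ → E} (hg : Continuous fun w : Circle => g w) :
    ∫ w : Circle, g w ∂normalizedLebesgue = Real.circleAverage g 0 1 := by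
  rw [normalizedLebesgue, integral_map (by fun_prop) hg.aestronglyMeasurable, integral_smul_measure,
    Real.circleAverage_def, ← intervalIntegral.integral_of_le (by linarith [Real.pi_pos]),
    ENNReal.toReal_inv, ENNReal.toReal_ofReal (by positivity)]
  congr 1
  have hper : Function.Periodic (fun x : ℝ => g (Circle.exp x)) (2 * Real.pi) := fun x => by
    simp
  have := hper.intervalIntegral_add_eq (-Real.pi) 0
  rw [show -Real.pi + 2 * Real.pi = Real.pi by ring, zero_add] at this
  rw [this]
  simp [circleMap, Circle.coe_exp]

/-- The dilation `z ↦ G (r z)` is continuous up to the boundary, so Poisson's formula applies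
although `G` itself may have no boundary values. -/
lemma integral_poisson_mul_re {G : ℂ → ℂ} (hG : DifferentiableOn ℂ G (Metric.ball 0 1)) {r : ℝ}
    (hr0 : 0 ≤ r) (hr : r < 1) {z : ℂ} (hz : ‖z‖ < 1) :
    ∫ w : Circle, ((1 - ‖z‖ ^ 2) / ‖(w : ℂ) - z‖ ^ 2) * (G (r * w)).re ∂normalizedLebesgue =
      (G (r * z)).re := by
  have hmaps : MapsTo (fun z : ℂ => (r : ℂ) * z) (Metric.closedBall 0 1) (Metric.ball 0 1) := by
    intro z hz
    rw [mem_closedBall_zero_iff] at hz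
    rw [mem_ball_zero_iff, norm_mul, Complex.norm_real, Real.norm_of_nonneg hr0]
    nlinarith [norm_nonneg z]
  have hcont : ContinuousOn (fun z : ℂ => G (r * z)) (Metric.closedBall 0 1) :=
    hG.continuousOn.comp (by fun_prop) hmaps
  have hdcc : DiffContOnCl ℂ (fun z : ℂ => G (r * z)) (Metric.ball 0 1) := by
    refine ⟨hG.comp (by fun_prop) (hmaps.mono_left Metric.ball_subset_closedBall), ?_⟩
    rwa [closure_ball _ one_ne_zero]
  have hp := hdcc.circleAverage_poissonKernel_smul (w := z) (by rwa [mem_ball_zero_iff])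
  have hcontC : Continuous fun w : Circle => G (r * w) :=
    hcont.comp_continuous (by fun_prop) fun w =>
      mem_closedBall_zero_iff.2 (Circle.norm_coe w).le
  have heq : ∀ w : Circle, (poissonKernel 0 z • fun z : ℂ => G (r * z)) w =
      ((1 - ‖z‖ ^ 2) / ‖(w : ℂ) - z‖ ^ 2) • G (r * w) := fun w => by
    rw [Pi.smul_apply', poissonKernel_def, sub_zero, sub_zero, Circle.norm_coe, one_pow]
  have hcP : Continuous fun w : Circle => ((1 - ‖z‖ ^ 2) / ‖(w : ℂ) - z‖ ^ 2) • G (r * w) :=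
    (continuous_poisson hz).smul hcontC
  rw [← integral_normalizedLebesgue (by simpa only [heq] using hcP)] at hp
  simp only [heq] at hp
  rw [← hp, ← Complex.reCLM_apply, ← Complex.reCLM.integral_comp_comm
    (integrable_of_continuous _ hcP)]
  simp only [Complex.reCLM_apply, Complex.smul_re, smul_eq_mul]

/-- **Herglotz representation**: a holomorphic function with positive real part on the disc is the
shifted Cauchy transform of a finite positive measure. -/
theorem exists_shiftedCauchyTransform_eq {G : ℂ → ℂ} (hG : DifferentiableOn ℂ G (Metric.ball 0 1))
    (hre : ∀ z : ℂ, ‖z‖ < 1 → 0 < (G z).re) :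
    ∃ mu : Measure Circle, IsFiniteMeasure mu ∧ mu ≠ 0 ∧
      ∀ z : ℂ, ‖z‖ < 1 → G z = shiftedCauchyTransform mu (G 0).im z := by
  have hM : 0 < (G 0).re := hre 0 (by simp)
  set M := (G 0).re with hMdef
  let r : ℕ → ℝ := fun n => 1 - 1 / ((n : ℝ) + 1)
  have hr1 : ∀ n, r n < 1 := fun n => sub_lt_self _ (by positivity)
  have hr0 : ∀ n, 0 ≤ r n := fun n => by
    have : 1 / ((n : ℝ) + 1) ≤ 1 := by
      rw [div_le_one (by positivity)]
      linarith [n.cast_nonneg (α := ℝ)]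
    simp only [r]
    linarith
  have hrlim : Tendsto r atTop (𝓝 1) := by
    simpa [r] using tendsto_one_div_add_atTop_nhds_zero_nat.const_sub (1 : ℝ)
  have hnorm : ∀ n (z : ℂ), ‖z‖ ≤ 1 → ‖(r n : ℂ) * z‖ < 1 := fun n z hz => by
    rw [norm_mul, Complex.norm_real, Real.norm_of_nonneg (hr0 n)]
    nlinarith [norm_nonneg z, hr0 n, hr1 n]
  let d : ℕ → Circle → NNReal := fun n w => ((G (r n * w)).re / M).toNNReal
  have hdc : ∀ n, Continuous (d n) := fun n => by
    refine continuous_real_toNNReal.comp (Continuous.div_const ?_ _)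
    refine Complex.continuous_re.comp (hG.continuousOn.comp_continuous (by fun_prop) fun w => ?_)
    rw [mem_ball_zero_iff]
    exact hnorm n w (Circle.norm_coe w).le
  have hd : ∀ n w, (d n w : ℝ) = (G (r n * w)).re / M := fun n w =>
    Real.coe_toNNReal _ (div_nonneg (hre _ (hnorm n w (Circle.norm_coe w).le)).le hM.le)
  -- Densities are the real parts on circles of radius `r n`, divided by `M = Re G(0)`; the mean
  -- value property makes these probability measures.
  let p : ℕ → Measure Circle := fun n => normalizedLebesgue.withDensity fun w => d n w
  have hint : ∀ n (z : ℂ), ‖z‖ < 1 →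
      ∫ w : Circle, (1 - ‖z‖ ^ 2) / ‖(w : ℂ) - z‖ ^ 2 ∂(p n) = (G (r n * z)).re / M := by
    intro n z hz
    rw [integral_withDensity_eq_integral_smul (hdc n).measurable,
      ← integral_poisson_mul_re hG (hr0 n) (hr1 n) hz, ← integral_div]
    refine integral_congr_ae (ae_of_all _ fun w => ?_)
    simp only [NNReal.smul_def, hd, smul_eq_mul]
    ring
  have hprob : ∀ n, IsProbabilityMeasure (p n) := by
    intro n
    have hfin : IsFiniteMeasure (p n) := by
      have h := isFiniteMeasure_withDensity_ofReal (μ := normalizedLebesgue)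
        (f := fun w => (d n w : ℝ)) (integrable_of_continuous _ (by fun_prop)).2
      simpa [p] using h
    have h1 := hint n 0 (by simp)
    simp only [norm_zero, sub_zero, Circle.norm_coe, mul_zero] at h1
    rw [← hMdef, div_self hM.ne'] at h1
    have h2 : (p n).real univ = 1 := by simpa using h1
    constructor
    rw [← ENNReal.toReal_eq_one_iff]
    exact h2
  let P : ℕ → ProbabilityMeasure Circle := fun n => ⟨p n, hprob n⟩
  -- Weak compactness of the probability measures on the circle; limits are taken along an
  -- ultrafilter instead of a subsequence.
  obtain ⟨nu, hnu⟩ := exists_clusterPt_of_compactSpace (map P atTop)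
  obtain ⟨U, hU, hUnu⟩ := mapClusterPt_iff_ultrafilter.1 hnu
  rw [ProbabilityMeasure.tendsto_iff_forall_integral_tendsto] at hUnu
  have hlim : ∀ z : ℂ, ‖z‖ < 1 →
      ∫ w : Circle, (1 - ‖z‖ ^ 2) / ‖(w : ℂ) - z‖ ^ 2 ∂(nu : Measure Circle) = (G z).re / M := by
    intro z hz
    have h1 := hUnu (BoundedContinuousFunction.mkOfCompact ⟨_, continuous_poisson hz⟩)
    refine tendsto_nhds_unique h1 ?_
    refine Tendsto.congr (fun n => (hint n z hz).symm) ?_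
    refine Tendsto.mono_left ?_ hU
    have h2 : Tendsto (fun n => (r n : ℂ) * z) atTop (𝓝 (1 * z)) :=
      ((Complex.continuous_ofReal.tendsto 1).comp hrlim).mul_const z
    rw [one_mul] at h2
    have h3 : ContinuousAt G z :=
      hG.continuousOn.continuousAt (Metric.isOpen_ball.mem_nhds (by rwa [mem_ball_zero_iff]))
    exact ((Complex.continuous_re.tendsto _).comp (h3.tendsto.comp h2)).div_const M
  let mu : Measure Circle := M.toNNReal • (nu : Measure Circle)
  have hMcoe : ((M.toNNReal : NNReal) : ℝ) = M := Real.coe_toNNReal _ hM.le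
  have hre_eq : ∀ z : ℂ, ‖z‖ < 1 → (cauchyTransform mu z).re = (G z).re := by
    intro z hz
    rw [re_cauchyTransform mu hz, integral_smul_nnreal_measure, hlim z hz, NNReal.smul_def, hMcoe,
      smul_eq_mul, mul_div_cancel₀ _ hM.ne']
  have hdiff : AnalyticOnNhd ℂ (fun z => G z - cauchyTransform mu z) (Metric.ball 0 1) :=
    (hG.sub (differentiableOn_cauchyTransform mu)).analyticOnNhd Metric.isOpen_ball
  -- The real parts agree, so the two holomorphic functions differ by a constant, which evaluation
  -- at 0 identifies.
  obtain ⟨a, ha⟩ := hdiff.eq_const_of_re_eq_const (c₀ := 0) (fun z hz => by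
    rw [mem_ball_zero_iff] at hz
    simp [hre_eq z hz]) Metric.isOpen_ball (Metric.isConnected_ball one_pos)
  refine ⟨mu, inferInstance, ?_, fun z hz => ?_⟩
  · intro h0
    have := hre_eq 0 (by simp)
    rw [h0, cauchyTransform_zero] at this
    simp [← hMdef, hM.ne] at this
  · have h1 := ha _ (show z ∈ Metric.ball 0 1 by rwa [mem_ball_zero_iff])
    have h2 := ha _ (show (0 : ℂ) ∈ Metric.ball 0 1 by simp)
    rw [← h2, cauchyTransform_zero] at h1
    have h3 := hre_eq 0 (by simp)
    rw [cauchyTransform_zero, Complex.ofReal_re] at h3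
    rw [shiftedCauchyTransform, sub_eq_iff_eq_add.1 h1, h3]
    linear_combination -Complex.re_add_im (G 0)

/-! ### Fatou's theorem -/

lemma measurableEmbedding_coe : MeasurableEmbedding fun w : Circle => (w : ℂ) :=
  (Continuous.isClosedEmbedding (X := Circle) (by fun_prop)
    fun _ _ h => Circle.coe_injective h).measurableEmbedding

lemma dist_circle (w z : Circle) : dist w z = ‖(w : ℂ) - z‖ := by
  rw [← dist_eq_norm]
  rfl

/-- Differentiation of measures on the circle along closed balls. -/
lemma ae_tendsto_closedBall_div (rho mu : Measure Circle) [IsFiniteMeasure rho]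
    [IsFiniteMeasure mu] :
    ∀ᵐ z : Circle ∂mu,
      Tendsto (fun δ : ℝ => rho (Metric.closedBall z δ) / mu (Metric.closedBall z δ)) (𝓝[>] 0)
        (𝓝 (rho.rnDeriv mu z)) := by
  have hm := measurableEmbedding_coe
  -- The Besicovitch theorem is applied in `ℂ` to the image measures; closed balls pull back to
  -- chordal closed balls.
  have h1 := ae_of_ae_map hm.measurable.aemeasurable (Besicovitch.ae_tendsto_rnDeriv
    (rho.map fun w : Circle => (w : ℂ)) (mu.map fun w : Circle => (w : ℂ)))
  filter_upwards [h1, hm.rnDeriv_map rho mu] with z hz hz'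
  rw [← hz']
  have hpre : ∀ δ, (fun w : Circle => (w : ℂ)) ⁻¹' Metric.closedBall (z : ℂ) δ =
      Metric.closedBall z δ := fun δ => rfl
  simpa only [hm.map_apply, hpre] using hz

/-- Layer-cake formula: the superlevel sets of a decreasing radial function are balls. Levels above
`φ η` give radii below `η`, where the hypothesis compares the measures; levels up to `φ η` cost at
most `φ η` times the total mass. -/
lemma lintegral_radial_le {mu nu : Measure Circle} {z : Circle} {φ : ℝ → ℝ} {η : ℝ} (hη : 0 ≤ η)
    (hφ : StrictAntiOn φ (Ici 0)) (hφc : Continuous φ) (hφ0 : ∀ x, 0 ≤ φ x)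
    (h : ∀ δ ∈ Ioo 0 η, mu (Metric.closedBall z δ) ≤ nu (Metric.closedBall z δ)) :
    ∫⁻ w, ENNReal.ofReal (φ (dist w z)) ∂mu ≤
      ∫⁻ w, ENNReal.ofReal (φ (dist w z)) ∂nu + ENNReal.ofReal (φ η) * mu univ := by
  have hm : Measurable fun w : Circle => φ (dist w z) := by fun_prop
  rw [lintegral_eq_lintegral_meas_le mu (ae_of_all _ fun w => hφ0 _) hm.aemeasurable,
    lintegral_eq_lintegral_meas_le nu (ae_of_all _ fun w => hφ0 _) hm.aemeasurable]
  have hind : ∫⁻ t in Ioi (0 : ℝ), (Iic (φ η)).indicator (fun _ => mu univ) t =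
      ENNReal.ofReal (φ η) * mu univ := by
    rw [lintegral_indicator_const measurableSet_Iic, Measure.restrict_apply measurableSet_Iic,
      inter_comm, Ioi_inter_Iic, Real.volume_Ioc, sub_zero, mul_comm]
  rw [← hind, ← lintegral_add_right _ (measurable_const.indicator measurableSet_Iic)]
  refine lintegral_mono_ae ?_
  -- The level `φ 0` would give a ball of radius 0, which the hypothesis does not cover.
  have hne : ∀ᵐ t ∂(volume.restrict (Ioi (0 : ℝ))), t ≠ φ 0 :=
    ae_restrict_of_ae (Measure.ae_ne volume (φ 0))
  filter_upwards [hne] with t ht0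
  by_cases ht : t ≤ φ η
  · rw [indicator_of_mem (show t ∈ Iic (φ η) from ht)]
    exact (measure_mono (subset_univ _)).trans le_add_self
  · push Not at ht
    refine le_add_right ?_
    rcases lt_or_gt_of_ne ht0 with hlt | hgt
    · obtain ⟨s, hs, rfl⟩ := intermediate_value_Ioo' hη hφc.continuousOn ⟨ht, hlt⟩
      have : {w : Circle | φ s ≤ φ (dist w z)} = Metric.closedBall z s := by
        ext w
        exact hφ.le_iff_ge hs.1.le dist_nonneg
      rw [this]
      exact h s hs
    · have : {w : Circle | t ≤ φ (dist w z)} = ∅ := by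
        refine eq_empty_of_forall_notMem fun w hw => ?_
        have h1 : φ (dist w z) ≤ φ 0 := hφ.antitoneOn self_mem_Ici dist_nonneg dist_nonneg
        exact absurd (hw.trans h1) (not_le.2 hgt)
      rw [this, measure_empty]
      exact zero_le

/-- The Poisson kernel as a function of the chordal distance. -/
def radialPoisson (r x : ℝ) : ℝ := (1 - r ^ 2) / ((1 - r) ^ 2 + r * x ^ 2)

lemma norm_sub_mul_sq (r : ℝ) (w z : Circle) :
    ‖(w : ℂ) - r * z‖ ^ 2 = (1 - r) ^ 2 + r * dist w z ^ 2 := by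
  have hw := Circle.normSq_coe w
  have hz := Circle.normSq_coe z
  rw [dist_circle, ← Complex.normSq_eq_norm_sq, ← Complex.normSq_eq_norm_sq]
  rw [Complex.normSq_apply] at *
  simp
  rw [Complex.normSq_apply]
  simp
  linear_combination (1 - r) * hw + (r ^ 2 - r) * hz

lemma norm_ofReal_mul_coe {r : ℝ} (hr : 0 ≤ r) (z : Circle) : ‖(r : ℂ) * z‖ = r := by
  rw [norm_mul, Circle.norm_coe, mul_one, Complex.norm_real, Real.norm_of_nonneg hr]

lemma radialPoisson_eq {r : ℝ} (hr : 0 ≤ r) (w z : Circle) :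
    (1 - ‖(r : ℂ) * z‖ ^ 2) / ‖(w : ℂ) - r * z‖ ^ 2 = radialPoisson r (dist w z) := by
  rw [norm_ofReal_mul_coe hr, norm_sub_mul_sq, radialPoisson]

lemma radialPoisson_denom_pos {r : ℝ} (hr0 : 0 < r) (hr1 : r < 1) (x : ℝ) :
    0 < (1 - r) ^ 2 + r * x ^ 2 := by
  have : 0 < 1 - r := sub_pos.2 hr1
  positivity

lemma radialPoisson_nonneg {r : ℝ} (hr0 : 0 < r) (hr1 : r < 1) (x : ℝ) :
    0 ≤ radialPoisson r x :=
  div_nonneg (by nlinarith) (radialPoisson_denom_pos hr0 hr1 x).le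

lemma continuous_radialPoisson {r : ℝ} (hr0 : 0 < r) (hr1 : r < 1) :
    Continuous (radialPoisson r) :=
  Continuous.div₀ (by fun_prop) (by fun_prop) fun x => (radialPoisson_denom_pos hr0 hr1 x).ne'

lemma strictAntiOn_radialPoisson {r : ℝ} (hr0 : 0 < r) (hr1 : r < 1) :
    StrictAntiOn (radialPoisson r) (Ici 0) := by
  intro x hx y hy hxy
  rw [mem_Ici] at hx hy
  have := radialPoisson_denom_pos hr0 hr1 x
  refine div_lt_div_of_pos_left (by nlinarith) this ?_
  have : x ^ 2 < y ^ 2 := by gcongr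
  gcongr

lemma tendsto_radialPoisson {η : ℝ} (hη : 0 < η) :
    Tendsto (fun r => radialPoisson r η) (𝓝[<] 1) (𝓝 0) := by
  have : ContinuousAt (fun r => radialPoisson r η) 1 := by
    refine ContinuousAt.div (by fun_prop) (by fun_prop) ?_
    simp [hη.ne']
  have h := this.tendsto.mono_left (nhdsWithin_le_nhds (s := Iio 1))
  simpa [radialPoisson] using h

lemma eventually_Ioo_left : ∀ᶠ r : ℝ in 𝓝[<] 1, r ∈ Ioo (0 : ℝ) 1 :=
  Ioo_mem_nhdsLT one_pos

lemma ofReal_re_cauchyTransform (mu : Measure Circle) [IsFiniteMeasure mu] {r : ℝ} (hr0 : 0 < r)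
    (hr1 : r < 1) (z : Circle) :
    ENNReal.ofReal (cauchyTransform mu (r * z)).re =
      ∫⁻ w, ENNReal.ofReal (radialPoisson r (dist w z)) ∂mu := by
  have hz : ‖(r : ℂ) * z‖ < 1 := by rwa [norm_ofReal_mul_coe hr0.le]
  rw [re_cauchyTransform mu hz, ofReal_integral_eq_lintegral_ofReal
    (integrable_of_continuous mu (continuous_poisson hz))
    (ae_of_all _ fun w => (poisson_pos w hz).le)]
  simp only [radialPoisson_eq hr0.le]

lemma re_cauchyTransform_normalizedLebesgue {z : ℂ} (hz : ‖z‖ < 1) :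
    (cauchyTransform normalizedLebesgue z).re = 1 := by
  have := integral_poisson_mul_re (G := fun _ => 1) (differentiableOn_const _) le_rfl one_pos hz
  rw [re_cauchyTransform _ hz]
  simpa using this

lemma cauchyTransform_smul (c : NNReal) (mu : Measure Circle) (z : ℂ) :
    cauchyTransform (c • mu) z = c * cauchyTransform mu z := by
  rw [cauchyTransform, integral_smul_nnreal_measure, cauchyTransform, NNReal.smul_def,
    Complex.real_smul]

/-- The Poisson kernel at a fixed distance `η` tends to 0 as `r → 1`, so a comparison of small balls
passes to the Poisson integrals up to `ε`. -/
lemma eventually_re_cauchyTransform_le {mu nu : Measure Circle} [IsFiniteMeasure mu]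
    [IsFiniteMeasure nu] {z : Circle}
    (h : ∀ᶠ δ in 𝓝[>] (0 : ℝ), mu (Metric.closedBall z δ) ≤ nu (Metric.closedBall z δ))
    {ε : ℝ} (hε : 0 < ε) :
    ∀ᶠ r : ℝ in 𝓝[<] 1,
      (cauchyTransform mu (r * z)).re ≤ (cauchyTransform nu (r * z)).re + ε := by
  obtain ⟨η, hη, hsub⟩ := mem_nhdsGT_iff_exists_Ioo_subset.1 h
  have hlim : Tendsto (fun r => radialPoisson r η * mu.real univ) (𝓝[<] 1) (𝓝 0) := by
    simpa using (tendsto_radialPoisson hη).mul_const (mu.real univ)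
  filter_upwards [eventually_Ioo_left, hlim.eventually_le_const hε] with r hr hrε
  have hz : ‖(r : ℂ) * z‖ < 1 := by rw [norm_ofReal_mul_coe hr.1.le]; exact hr.2
  have h0 := radialPoisson_nonneg hr.1 hr.2 η
  have h1 := lintegral_radial_le (mem_Ioi.1 hη).le (strictAntiOn_radialPoisson hr.1 hr.2)
    (continuous_radialPoisson hr.1 hr.2) (radialPoisson_nonneg hr.1 hr.2) fun δ hδ => hsub hδ
  rw [← ofReal_re_cauchyTransform mu hr.1 hr.2, ← ofReal_re_cauchyTransform nu hr.1 hr.2,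
    ← ofReal_measureReal, ← ENNReal.ofReal_mul h0,
    ← ENNReal.ofReal_add (re_cauchyTransform_nonneg nu hz) (by positivity),
    ENNReal.ofReal_le_ofReal_iff
      (add_nonneg (re_cauchyTransform_nonneg nu hz) (by positivity))] at h1
  linarith

/-- Comparison with `c` times Lebesgue measure, whose Poisson integral is the constant `c`, for `c`
just below and just above `D`. -/
lemma tendsto_re_cauchyTransform {mu : Measure Circle} [IsFiniteMeasure mu] {z : Circle}
    {D : ENNReal} (hD : D ≠ ⊤)
    (h : Tendsto (fun δ : ℝ => mu (Metric.closedBall z δ) /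
      normalizedLebesgue (Metric.closedBall z δ)) (𝓝[>] 0) (𝓝 D)) :
    Tendsto (fun r : ℝ => (cauchyTransform mu (r * z)).re) (𝓝[<] 1) (𝓝 D.toReal) := by
  lift D to NNReal using hD
  have hsigma : ∀ (c : NNReal) (r : ℝ), r ∈ Ioo (0 : ℝ) 1 →
      (cauchyTransform (c • normalizedLebesgue) (r * z)).re = c := by
    intro c r hr
    have hz : ‖(r : ℂ) * z‖ < 1 := by rw [norm_ofReal_mul_coe hr.1.le]; exact hr.2
    simp [cauchyTransform_smul, re_cauchyTransform_normalizedLebesgue hz]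
  rw [ENNReal.coe_toReal, tendsto_order]
  constructor
  · intro a ha
    rcases lt_or_ge a 0 with ha0 | ha0
    · filter_upwards [eventually_Ioo_left] with r hr
      refine ha0.trans_le (re_cauchyTransform_nonneg mu ?_)
      rw [norm_ofReal_mul_coe hr.1.le]; exact hr.2
    · lift a to NNReal using ha0
      obtain ⟨c, hac, hcD⟩ := exists_between (NNReal.coe_lt_coe.1 ha)
      have hb : ∀ᶠ δ in 𝓝[>] (0 : ℝ), (c • normalizedLebesgue) (Metric.closedBall z δ) ≤
          mu (Metric.closedBall z δ) := by
        filter_upwards [h.eventually_const_le (ENNReal.coe_lt_coe.2 hcD)] with δ hδ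
        exact ENNReal.mul_le_of_le_div hδ
      filter_upwards [eventually_Ioo_left, eventually_re_cauchyTransform_le hb
        (half_pos (sub_pos.2 (NNReal.coe_lt_coe.2 hac)))] with r hr h1
      rw [hsigma c r hr] at h1
      have := NNReal.coe_lt_coe.2 hac
      linarith
  · intro a ha
    have ha0 : 0 ≤ a := D.coe_nonneg.trans ha.le
    lift a to NNReal using ha0
    obtain ⟨c, hDc, hca⟩ := exists_between (NNReal.coe_lt_coe.1 ha)
    have hb : ∀ᶠ δ in 𝓝[>] (0 : ℝ), mu (Metric.closedBall z δ) ≤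
        (c • normalizedLebesgue) (Metric.closedBall z δ) := by
      filter_upwards [h.eventually_le_const (ENNReal.coe_lt_coe.2 hDc)] with δ hδ
      rw [ENNReal.div_le_iff_le_mul (Or.inr ENNReal.coe_ne_top) (Or.inl (measure_ne_top _ _))] at hδ
      exact hδ
    filter_upwards [eventually_Ioo_left, eventually_re_cauchyTransform_le hb
      (half_pos (sub_pos.2 (NNReal.coe_lt_coe.2 hca)))] with r hr h1
    rw [hsigma c r hr] at h1
    have := NNReal.coe_lt_coe.2 hca
    linarith

/-- **Fatou's theorem**: the Poisson integral of a finite measure tends radially to its density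
almost everywhere. -/
theorem ae_tendsto_re_cauchyTransform (mu : Measure Circle) [IsFiniteMeasure mu] :
    ∀ᵐ z : Circle ∂normalizedLebesgue,
      Tendsto (fun r : ℝ => (cauchyTransform mu (r * z)).re) (𝓝[<] 1) (𝓝 (contDensity mu z)) := by
  filter_upwards [ae_tendsto_closedBall_div mu normalizedLebesgue,
    mu.rnDeriv_ne_top normalizedLebesgue] with z hz hz'
  exact tendsto_re_cauchyTransform hz' hz

lemma tendsto_re_cauchyTransform_atTop {mu : Measure Circle} [IsFiniteMeasure mu] {z : Circle}
    (h : Tendsto (fun δ : ℝ => normalizedLebesgue (Metric.closedBall z δ) /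
      mu (Metric.closedBall z δ)) (𝓝[>] 0) (𝓝 0)) :
    Tendsto (fun r : ℝ => (cauchyTransform mu (r * z)).re) (𝓝[<] 1) atTop := by
  refine tendsto_atTop.2 fun b => ?_
  obtain ⟨c, hc⟩ := exists_nat_gt (max b 1)
  have hc1 : 1 < (c : ℝ) := (le_max_right _ _).trans_lt hc
  -- With error `1/2`, comparison gives `1 ≤ Re Q / (2c) + 1/2`, that is `Re Q ≥ c > b`.
  let d : NNReal := (2 * (c : NNReal))⁻¹
  have hd : (d : ℝ) = (2 * (c : ℝ))⁻¹ := by simp [d]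
  have hd0 : 0 < d := NNReal.coe_pos.1 (by rw [hd]; positivity)
  have hb : ∀ᶠ δ in 𝓝[>] (0 : ℝ), normalizedLebesgue (Metric.closedBall z δ) ≤
      (d • mu) (Metric.closedBall z δ) := by
    filter_upwards [h.eventually_le_const (ENNReal.coe_pos.2 hd0)] with δ hδ
    rw [ENNReal.div_le_iff_le_mul (Or.inr ENNReal.coe_ne_top) (Or.inl (measure_ne_top _ _))] at hδ
    exact hδ
  filter_upwards [eventually_Ioo_left, eventually_re_cauchyTransform_le hb one_half_pos]
    with r hr h1
  have hz : ‖(r : ℂ) * z‖ < 1 := by rw [norm_ofReal_mul_coe hr.1.le]; exact hr.2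
  rw [re_cauchyTransform_normalizedLebesgue hz, cauchyTransform_smul] at h1
  have h2 : ((d : ℂ) * cauchyTransform mu (r * z)).re =
      (2 * (c : ℝ))⁻¹ * (cauchyTransform mu (r * z)).re := by
    rw [← hd]
    simp
  rw [h2] at h1
  have h3 : (2 * (c : ℝ))⁻¹ * (cauchyTransform mu (r * z)).re * (2 * c) =
      (cauchyTransform mu (r * z)).re := by field_simp
  have h4 := le_max_left b 1
  nlinarith

/-- The Poisson integral of a finite measure tends radially to infinity almost everywhere for the
singular part. -/
theorem ae_tendsto_re_cauchyTransform_singularPart (mu : Measure Circle) [IsFiniteMeasure mu] :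
    ∀ᵐ z : Circle ∂(mu.singularPart normalizedLebesgue),
      Tendsto (fun r : ℝ => (cauchyTransform mu (r * z)).re) (𝓝[<] 1) atTop := by
  have hs : normalizedLebesgue.rnDeriv (mu.singularPart normalizedLebesgue) =ᵐ[
      mu.singularPart normalizedLebesgue] 0 :=
    Measure.rnDeriv_eq_zero_of_mutuallySingular
      (mu.mutuallySingular_singularPart normalizedLebesgue).symm Measure.AbsolutelyContinuous.rfl
  filter_upwards [hs, ae_tendsto_closedBall_div normalizedLebesgue
    (mu.singularPart normalizedLebesgue)] with z hz0 hz
  rw [hz0] at hz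
  refine tendsto_re_cauchyTransform_atTop (tendsto_of_tendsto_of_tendsto_of_le_of_le
    tendsto_const_nhds hz (fun _ => zero_le) fun δ => ?_)
  -- Replacing the singular part by the larger `mu` in the denominator only lowers the ratio.
  exact ENNReal.div_le_div_left (mu.singularPart_le normalizedLebesgue _) _

/-! ### Radial limits of functions with positive real part -/

lemma norm_ofReal_mul_coe_lt_one {r : ℝ} (hr : r ∈ Ioo (0 : ℝ) 1) (z : Circle) :
    ‖(r : ℂ) * z‖ < 1 := by
  rw [norm_ofReal_mul_coe hr.1.le]
  exact hr.2

lemma re_shiftedCauchyTransform (lam : Measure Circle) (σ : ℝ) (z : ℂ) :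
    (shiftedCauchyTransform lam σ z).re = (cauchyTransform lam z).re := by
  simp [shiftedCauchyTransform]

lemma im_shiftedCauchyTransform (lam : Measure Circle) (σ : ℝ) (z : ℂ) :
    (shiftedCauchyTransform lam σ z).im = (cauchyTransform lam z).im + σ := by
  simp [shiftedCauchyTransform]

lemma differentiableOn_shiftedCauchyTransform (lam : Measure Circle) [IsFiniteMeasure lam] (σ : ℝ) :
    DifferentiableOn ℂ (shiftedCauchyTransform lam σ) (Metric.ball 0 1) :=
  (differentiableOn_cauchyTransform lam).add_const _

lemma ae_exists_tendsto_re {G : ℂ → ℂ} (hG : DifferentiableOn ℂ G (Metric.ball 0 1))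
    (hre : ∀ z : ℂ, ‖z‖ < 1 → 0 < (G z).re) :
    ∀ᵐ z : Circle ∂normalizedLebesgue,
      ∃ l : ℝ, Tendsto (fun r : ℝ => (G (r * z)).re) (𝓝[<] 1) (𝓝 l) := by
  obtain ⟨mu, hmu, -, hG'⟩ := exists_shiftedCauchyTransform_eq hG hre
  filter_upwards [ae_tendsto_re_cauchyTransform mu] with z hz
  refine ⟨_, hz.congr' ?_⟩
  filter_upwards [eventually_Ioo_left] with r hr
  rw [hG' _ (norm_ofReal_mul_coe_lt_one hr z), re_shiftedCauchyTransform]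

/-- A holomorphic function with positive real part on the disc has finite radial limits almost
everywhere. -/
lemma ae_exists_tendsto {G : ℂ → ℂ} (hG : DifferentiableOn ℂ G (Metric.ball 0 1))
    (hre : ∀ z : ℂ, ‖z‖ < 1 → 0 < (G z).re) :
    ∀ᵐ z : Circle ∂normalizedLebesgue,
      ∃ l : ℂ, Tendsto (fun r : ℝ => G (r * z)) (𝓝[<] 1) (𝓝 l) := by
  have hlog : DifferentiableOn ℂ (fun z => Complex.log (G z)) (Metric.ball 0 1) :=
    hG.clog fun z hz => Or.inl (hre z (mem_ball_zero_iff.1 hz))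
  have harg : ∀ z : ℂ, ‖z‖ < 1 → |(G z).arg| < Real.pi / 2 := fun z hz =>
    Complex.abs_arg_lt_pi_div_two_iff.2 (Or.inl (hre z hz))
  -- `S = √G` has argument in `(-π/4, π/4)`, and `T`, its rotation by `π/4`, has argument in `(0,
  -- π/2)`. Both have positive real part, and `√2 Re T = Re S - Im S` recovers `Im S` from two real
  -- parts, whose limits exist by Fatou.
  let S : ℂ → ℂ := fun z => Complex.exp (Complex.log (G z) / 2)
  let T : ℂ → ℂ := fun z => Complex.exp (Complex.log (G z) / 2 + (Real.pi / 4 : ℝ) * Complex.I)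
  have hS : DifferentiableOn ℂ S (Metric.ball 0 1) := (hlog.div_const 2).cexp
  have hT : DifferentiableOn ℂ T (Metric.ball 0 1) := ((hlog.div_const 2).add_const _).cexp
  have him2 : ∀ z, (Complex.log (G z) / 2).im = (G z).arg / 2 := fun z => by
    simp [Complex.log_im]
  have hSre : ∀ z : ℂ, ‖z‖ < 1 → 0 < (S z).re := fun z hz => by
    have h := abs_lt.1 (harg z hz)
    rw [Complex.exp_re, him2]
    refine mul_pos (Real.exp_pos _) (Real.cos_pos_of_mem_Ioo ⟨?_, ?_⟩) <;>
      linarith [Real.pi_pos]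
  have hTre : ∀ z : ℂ, ‖z‖ < 1 → 0 < (T z).re := fun z hz => by
    have h := abs_lt.1 (harg z hz)
    rw [Complex.exp_re, Complex.add_im, him2, Complex.im_ofReal_mul, Complex.I_im, mul_one]
    refine mul_pos (Real.exp_pos _) (Real.cos_pos_of_mem_Ioo ⟨?_, ?_⟩) <;>
      linarith [Real.pi_pos]
  have hST : ∀ z, (S z).im = (S z).re - √2 * (T z).re := fun z => by
    have hT : T z = S z * Complex.exp ((Real.pi / 4 : ℝ) * Complex.I) := Complex.exp_add _ _
    rw [hT, Complex.mul_re, Complex.exp_ofReal_mul_I_re, Complex.exp_ofReal_mul_I_im,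
      Real.cos_pi_div_four, Real.sin_pi_div_four]
    have := Real.mul_self_sqrt (show (0 : ℝ) ≤ 2 by norm_num)
    linear_combination ((S z).re / 2 - (S z).im / 2) * this
  have hSsq : ∀ z : ℂ, ‖z‖ < 1 → S z ^ 2 = G z := fun z hz => by
    have h0 : G z ≠ 0 := fun h => by simpa [h] using hre z hz
    rw [← Complex.exp_nat_mul]
    push_cast
    rw [mul_div_cancel₀ _ two_ne_zero, Complex.exp_log h0]
  filter_upwards [ae_exists_tendsto_re hS hSre, ae_exists_tendsto_re hT hTre] with z ⟨a, ha⟩ ⟨b, hb⟩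
  have hlim : Tendsto (fun r : ℝ => S (r * z)) (𝓝[<] 1) (𝓝 (a + (a - √2 * b : ℝ) * Complex.I)) := by
    have him : Tendsto (fun r : ℝ => (S (r * z)).im) (𝓝[<] 1) (𝓝 (a - √2 * b)) := by
      simp only [hST]
      exact ha.sub (hb.const_mul _)
    have h1 := ((Complex.continuous_ofReal.tendsto _).comp ha).add
      (((Complex.continuous_ofReal.tendsto _).comp him).mul_const Complex.I)
    refine h1.congr fun r => ?_
    exact Complex.re_add_im _
  refine ⟨_, (hlim.pow 2).congr' ?_⟩
  filter_upwards [eventually_Ioo_left] with r hr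
  exact hSsq _ (norm_ofReal_mul_coe_lt_one hr z)

/-! ### The reciprocal transform: existence, uniqueness, absolutely continuous part -/

lemma re_shiftedCauchyTransform_pos {lam : Measure Circle} [IsFiniteMeasure lam]
    (hlam : lam ≠ 0) (c₀ : ℝ) {z : ℂ} (hz : ‖z‖ < 1) :
    0 < (shiftedCauchyTransform lam c₀ z).re := by
  rw [re_shiftedCauchyTransform]
  exact re_cauchyTransform_pos lam hlam hz

lemma shiftedCauchyTransform_ne_zero {lam : Measure Circle} [IsFiniteMeasure lam]
    (hlam : lam ≠ 0) (c₀ : ℝ) {z : ℂ} (hz : ‖z‖ < 1) :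
    shiftedCauchyTransform lam c₀ z ≠ 0 := fun h => by
  simpa [h] using re_shiftedCauchyTransform_pos hlam c₀ hz

lemma differentiableOn_inv_shiftedCauchyTransform {lam : Measure Circle} [IsFiniteMeasure lam]
    (hlam : lam ≠ 0) (c₀ : ℝ) :
    DifferentiableOn ℂ (fun z => (shiftedCauchyTransform lam c₀ z)⁻¹) (Metric.ball 0 1) :=
  (differentiableOn_shiftedCauchyTransform lam c₀).inv fun _ hz =>
    shiftedCauchyTransform_ne_zero hlam c₀ (mem_ball_zero_iff.1 hz)

lemma re_inv_shiftedCauchyTransform_pos {lam : Measure Circle} [IsFiniteMeasure lam]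
    (hlam : lam ≠ 0) (c₀ : ℝ) {z : ℂ} (hz : ‖z‖ < 1) :
    0 < (shiftedCauchyTransform lam c₀ z)⁻¹.re := by
  rw [Complex.inv_re]
  exact div_pos (re_shiftedCauchyTransform_pos hlam c₀ hz)
    (Complex.normSq_pos.2 (shiftedCauchyTransform_ne_zero hlam c₀ hz))

lemma exists_isInterconversion {lam : Measure Circle} [IsFiniteMeasure lam]
    (hlam : lam ≠ 0) (c₀ : ℝ) :
    ∃ mu, IsInterconversion lam c₀ mu (shiftedCauchyTransform lam c₀ 0)⁻¹.im := by
  obtain ⟨mu, h1, h2, h3⟩ := exists_shiftedCauchyTransform_eq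
    (differentiableOn_inv_shiftedCauchyTransform hlam c₀)
    fun z hz => re_inv_shiftedCauchyTransform_pos hlam c₀ hz
  refine ⟨mu, h1, h2, fun z hz => ?_⟩
  rw [← h3 z hz]
  exact mul_inv_cancel₀ (shiftedCauchyTransform_ne_zero hlam c₀ hz)

lemma existsUnique_isInterconversion {lam : Measure Circle} [IsFiniteMeasure lam]
    (hlam : lam ≠ 0) (c₀ : ℝ) :
    ∃! p : Measure Circle × ℝ, IsInterconversion lam c₀ p.1 p.2 := by
  obtain ⟨mu, hmu⟩ := exists_isInterconversion hlam c₀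
  refine ⟨(mu, _), hmu, fun p hp => ?_⟩
  have := hmu.finite
  have := hp.finite
  have h := measure_eq_of_shiftedCauchyTransform_eq (mu := p.1) (nu := mu) fun z hz =>
    mul_left_cancel₀ (shiftedCauchyTransform_ne_zero hlam c₀ hz)
      ((hp.mul_eq_one z hz).trans (hmu.mul_eq_one z hz).symm)
  exact Prod.ext h.1 h.2

/-- Almost everywhere, `Q_{c₀}[lam]` has the nonzero radial limit `lam_c + i (H[lam] + c₀)`. -/
lemma ae_tendsto_shiftedCauchyTransform {lam : Measure Circle} [IsFiniteMeasure lam]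
    (hlam : lam ≠ 0) (c₀ : ℝ) :
    ∀ᵐ z : Circle ∂normalizedLebesgue, HasHilbertTransformAt lam z (hilbertTransform lam z) ∧
      ∃ l : ℂ, l ≠ 0 ∧ l.re = contDensity lam z ∧ l.im = hilbertTransform lam z + c₀ ∧
        Tendsto (fun r : ℝ => shiftedCauchyTransform lam c₀ (r * z)) (𝓝[<] 1) (𝓝 l) := by
  filter_upwards [ae_exists_tendsto (differentiableOn_shiftedCauchyTransform lam c₀)
      fun z hz => re_shiftedCauchyTransform_pos hlam c₀ hz,
    ae_exists_tendsto (differentiableOn_inv_shiftedCauchyTransform hlam c₀)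
      fun z hz => re_inv_shiftedCauchyTransform_pos hlam c₀ hz,
    ae_tendsto_re_cauchyTransform lam] with z ⟨l, hl⟩ ⟨m, hm⟩ hz
  -- The reciprocal also has a finite limit almost everywhere, which rules out `l = 0`.
  have hprod : l * m = 1 := by
    refine tendsto_nhds_unique (hl.mul hm) (tendsto_const_nhds.congr' ?_)
    filter_upwards [eventually_Ioo_left] with r hr
    exact (mul_inv_cancel₀
      (shiftedCauchyTransform_ne_zero hlam c₀ (norm_ofReal_mul_coe_lt_one hr z))).symm
  have hre := (Complex.continuous_re.tendsto l).comp hl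
  have him := ((Complex.continuous_im.tendsto l).comp hl).sub_const c₀
  have hH : HasHilbertTransformAt lam z (l.im - c₀) := by
    refine him.congr fun r => ?_
    simp [im_shiftedCauchyTransform]
  have hHeq : hilbertTransform lam z = l.im - c₀ := hH.limUnder_eq
  refine ⟨hHeq ▸ hH, l, left_ne_zero_of_mul_eq_one hprod, ?_, by rw [hHeq, sub_add_cancel], hl⟩
  refine tendsto_nhds_unique hre (hz.congr fun r => ?_)
  exact (re_shiftedCauchyTransform lam c₀ _).symm

lemma IsInterconversion.eq_inv {lam : Measure Circle} {c₀ : ℝ} {mu : Measure Circle} {ζ₀ : ℝ}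
    (h : IsInterconversion lam c₀ mu ζ₀) {z : ℂ} (hz : ‖z‖ < 1) :
    shiftedCauchyTransform mu ζ₀ z = (shiftedCauchyTransform lam c₀ z)⁻¹ :=
  eq_inv_of_mul_eq_one_right (h.mul_eq_one z hz)

lemma IsInterconversion.contDensity_ae_eq {lam : Measure Circle} [IsFiniteMeasure lam]
    (hlam : lam ≠ 0) (c₀ : ℝ) {mu : Measure Circle} {ζ₀ : ℝ}
    (h : IsInterconversion lam c₀ mu ζ₀) :
    contDensity mu =ᵐ[normalizedLebesgue] interconvertedDensity lam c₀ := by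
  have := h.finite
  filter_upwards [ae_tendsto_shiftedCauchyTransform hlam c₀, ae_tendsto_re_cauchyTransform mu]
    with z ⟨_, l, hl0, hre, him, hl⟩ hz
  have h1 := (Complex.continuous_re.tendsto _).comp (hl.inv₀ hl0)
  rw [interconvertedDensity, ← hre, ← him]
  have h2 : l⁻¹.re = l.re / (l.re ^ 2 + l.im ^ 2) := by
    rw [Complex.inv_re, Complex.normSq_apply, sq, sq]
  rw [← h2]
  refine tendsto_nhds_unique hz (h1.congr' ?_)
  filter_upwards [eventually_Ioo_left] with r hr
  rw [← re_shiftedCauchyTransform mu ζ₀, h.eq_inv (norm_ofReal_mul_coe_lt_one hr z)]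
  rfl

lemma integrable_interconvertedDensity {lam : Measure Circle} [IsFiniteMeasure lam]
    (hlam : lam ≠ 0) (c₀ : ℝ) :
    Integrable (interconvertedDensity lam c₀) normalizedLebesgue := by
  obtain ⟨mu, hmu⟩ := exists_isInterconversion hlam c₀
  have := hmu.finite
  exact (Measure.integrable_toReal_rnDeriv (μ := mu)).congr (hmu.contDensity_ae_eq hlam c₀)

lemma IsInterconversion.eq_singularPart_add {lam : Measure Circle} [IsFiniteMeasure lam]
    (hlam : lam ≠ 0) (c₀ : ℝ) {mu : Measure Circle} {ζ₀ : ℝ}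
    (h : IsInterconversion lam c₀ mu ζ₀) :
    mu = normalizedLebesgue.withDensity
        (fun z => ENNReal.ofReal (interconvertedDensity lam c₀ z)) +
      mu.singularPart normalizedLebesgue := by
  have := h.finite
  have hd : mu.rnDeriv normalizedLebesgue =ᵐ[normalizedLebesgue]
      fun z => ENNReal.ofReal (interconvertedDensity lam c₀ z) := by
    filter_upwards [h.contDensity_ae_eq hlam c₀, mu.rnDeriv_ne_top normalizedLebesgue] with z hz hz'
    rw [← hz, contDensity, ENNReal.ofReal_toReal hz']
  conv_lhs => rw [← Measure.rnDeriv_add_singularPart mu normalizedLebesgue]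
  rw [withDensity_congr_ae hd]

lemma IsInterconversion.shift_eq {lam : Measure Circle} [IsFiniteMeasure lam] {c₀ : ℝ}
    {mu : Measure Circle} {ζ₀ : ℝ} (h : IsInterconversion lam c₀ mu ζ₀) :
    ζ₀ = ((((lam.real univ : ℝ) : ℂ) + Complex.I * (c₀ : ℂ))⁻¹).im := by
  have := h.finite
  have h1 := h.eq_inv (z := 0) (by simp)
  rw [shiftedCauchyTransform, shiftedCauchyTransform, cauchyTransform_zero,
    cauchyTransform_zero] at h1
  rw [← h1]
  simp

/-! ### The singular part is carried by the atom set -/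

/-- At radius `1 - δ` the Poisson kernel is at least `1/δ` on the arc of half-width `δ`, so the mean
of `lam` over that arc is at most the Poisson integral. The point thus lies in each set of the
intersection before closure. -/
lemma mem_zeroSet_of_tendsto_re {lam : Measure Circle} [IsFiniteMeasure lam] {z : Circle}
    (h : Tendsto (fun r : ℝ => (cauchyTransform lam (r * z)).re) (𝓝[<] 1) (𝓝 0)) :
    z ∈ zeroSet lam := by
  refine mem_iInter₂.2 fun ε hε => subset_closure ⟨(z : ℂ).arg, ?_, Circle.exp_arg z⟩
  have hlim : Tendsto (fun δ : ℝ => ENNReal.ofReal (cauchyTransform lam ((1 - δ : ℝ) * z)).re)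
      (𝓝[>] 0) (𝓝 0) := by
    have h1 : Tendsto (fun δ : ℝ => 1 - δ) (𝓝[>] 0) (𝓝[<] 1) := by
      refine tendsto_nhdsWithin_iff.2 ⟨?_, ?_⟩
      · have : Tendsto (fun δ : ℝ => 1 - δ) (𝓝 0) (𝓝 (1 - 0)) := tendsto_id.const_sub 1
        rw [sub_zero] at this
        exact this.mono_left nhdsWithin_le_nhds
      · filter_upwards [self_mem_nhdsWithin] with δ hδ
        exact sub_lt_self _ (mem_Ioi.1 hδ)
    have := (ENNReal.continuous_ofReal.tendsto _).comp (h.comp h1)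
    rwa [ENNReal.ofReal_zero] at this
  refine lt_of_le_of_lt ?_ (ENNReal.ofReal_pos.2 hε)
  rw [← hlim.limsup_eq]
  refine limsup_le_limsup ?_
  filter_upwards [Ioo_mem_nhdsGT (one_pos (α := ℝ))] with δ hδ
  have hr0 : 0 < 1 - δ := sub_pos.2 hδ.2
  have hr1 : 1 - δ < 1 := sub_lt_self _ hδ.1
  rw [ofReal_re_cauchyTransform lam hr0 hr1]
  have hsub : Circle.exp '' Icc ((z : ℂ).arg - δ) ((z : ℂ).arg + δ) ⊆
      {w | ENNReal.ofReal δ⁻¹ ≤ ENNReal.ofReal (radialPoisson (1 - δ) (dist w z))} := by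
    rintro _ ⟨t, ht, rfl⟩
    refine ENNReal.ofReal_le_ofReal ?_
    -- A chord is no longer than its arc.
    have hd : dist (Circle.exp t) z ≤ δ := by
      have h1 : dist (Circle.exp t) z = ‖Complex.exp (Complex.I * (t - (z : ℂ).arg : ℝ)) - 1‖ := by
        conv_lhs => rw [← Circle.exp_arg z]
        rw [dist_circle, Circle.coe_exp, Circle.coe_exp]
        have : Complex.exp (t * Complex.I) - Complex.exp ((z : ℂ).arg * Complex.I) =
            (Complex.exp (Complex.I * (t - (z : ℂ).arg : ℝ)) - 1) *
              Complex.exp ((z : ℂ).arg * Complex.I) := by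
          rw [sub_mul, ← Complex.exp_add, one_mul]
          congr 2
          push_cast
          ring
        rw [this, norm_mul, Complex.norm_exp_ofReal_mul_I, mul_one]
      rw [h1]
      refine (Real.norm_exp_I_mul_ofReal_sub_one_le).trans ?_
      rw [Real.norm_eq_abs, abs_le]
      constructor <;> linarith [ht.1, ht.2]
    calc δ⁻¹ = radialPoisson (1 - δ) δ := by
          have : (1 - (1 - δ)) ^ 2 + (1 - δ) * δ ^ 2 = δ ^ 2 * (2 - δ) := by ring
          have h2 : 2 - δ ≠ 0 := by linarith [hδ.2]
          have h3 := hδ.1.ne'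
          rw [radialPoisson, this]
          field_simp
          ring
      _ ≤ _ := (strictAntiOn_radialPoisson hr0 hr1).antitoneOn dist_nonneg hδ.1.le hd
  -- Markov's inequality at level `1/δ`; the factor 2 in `2δ` is given away.
  refine le_trans ?_ ((mul_le_mul_right (measure_mono hsub) _).trans
    (mul_meas_ge_le_lintegral₀ ?_ (ENNReal.ofReal δ⁻¹)))
  · rw [ENNReal.ofReal_inv_of_pos hδ.1, mul_comm (_⁻¹), ← div_eq_mul_inv]
    exact ENNReal.div_le_div_left (ENNReal.ofReal_le_ofReal (by linarith [hδ.1])) _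
  · have := continuous_radialPoisson hr0 hr1
    exact Measurable.aemeasurable (by fun_prop)

lemma mem_atomSet_of_tendsto {lam : Measure Circle} [IsFiniteMeasure lam] {c₀ : ℝ} {z : Circle}
    (h : Tendsto (fun r : ℝ => shiftedCauchyTransform lam c₀ (r * z)) (𝓝[<] 1) (𝓝 0)) :
    z ∈ atomSet lam c₀ := by
  constructor
  · refine mem_zeroSet_of_tendsto_re ?_
    refine ((Complex.continuous_re.tendsto 0).comp h).congr fun r => ?_
    exact re_shiftedCauchyTransform lam c₀ _
  · have h1 := ((Complex.continuous_im.tendsto 0).comp h).sub_const c₀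
    rw [Complex.zero_im, zero_sub] at h1
    refine h1.congr fun r => ?_
    simp [im_shiftedCauchyTransform]

/-- `|Q_{c₀}[lam]| = 1/|Q_{ζ₀}[mu]| ≤ 1/Re Q[mu]`, and the right side tends to 0 almost everywhere
for the singular part. -/
lemma IsInterconversion.ae_mem_atomSet {lam : Measure Circle} [IsFiniteMeasure lam]
    {c₀ : ℝ} {mu : Measure Circle} {ζ₀ : ℝ} (h : IsInterconversion lam c₀ mu ζ₀) :
    ∀ᵐ z ∂(mu.singularPart normalizedLebesgue), z ∈ atomSet lam c₀ := by
  have := h.finite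
  filter_upwards [ae_tendsto_re_cauchyTransform_singularPart mu] with z hz
  refine mem_atomSet_of_tendsto (squeeze_zero_norm' ?_ hz.inv_tendsto_atTop)
  filter_upwards [eventually_Ioo_left] with r hr
  have h1 := h.eq_inv (norm_ofReal_mul_coe_lt_one hr z)
  have h2 := re_cauchyTransform_pos mu h.ne_zero (norm_ofReal_mul_coe_lt_one hr z)
  rw [← inv_inv (shiftedCauchyTransform lam c₀ _), ← h1, norm_inv, Pi.inv_apply]
  refine inv_anti₀ h2 ?_
  rw [← re_shiftedCauchyTransform mu ζ₀]
  exact Complex.re_le_norm _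

lemma atomSet_subset_candidateSet (lam : Measure Circle) (c₀ : ℝ) :
    atomSet lam c₀ ⊆ candidateSet lam c₀ := by
  intro z hz
  by_cases hs : z ∈ lam.support
  · exact Or.inl ⟨hz.1, hs⟩
  · exact Or.inr ⟨hs, hz.2⟩

lemma countable_of_isolated {X : Type*} [MetricSpace X] [SecondCountableTopology X] {s : Set X}
    (hs : ∀ z ∈ s, ∃ ε : ℝ, 0 < ε ∧ ∀ z' ∈ s, z' ≠ z → ε < dist z z') : s.Countable := by
  have : DiscreteTopology s := by
    refine discreteTopology_iff_isOpen_singleton.2 fun z => ?_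
    obtain ⟨ε, hε, h⟩ := hs z z.2
    have : {z} = Metric.ball z ε := by
      ext w
      rw [mem_singleton_iff, Metric.mem_ball]
      refine ⟨fun hw => by simpa [hw] using hε, fun hw => ?_⟩
      by_contra hne
      have := h w w.2 fun h => hne (Subtype.ext h)
      rw [dist_comm] at hw
      exact lt_asymm hw this
    rw [this]
    exact Metric.isOpen_ball
  exact countable_coe_iff.1 (TopologicalSpace.separableSpace_iff_countable.1 inferInstance)

lemma eq_sum_smul_dirac {X : Type*} [MeasurableSpace X] [MeasurableSingletonClass X]
    {mu : Measure X} {s : Set X} (hs : s.Countable) (h : ∀ᵐ x ∂mu, x ∈ s) :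
    mu = Measure.sum fun a : s => mu {(a : X)} • Measure.dirac (a : X) := by
  have := hs.to_subtype
  conv_lhs => rw [← Measure.restrict_eq_self_of_ae_mem h, ← iUnion_of_singleton_coe s]
  rw [Measure.restrict_iUnion (fun a b hab => by simpa [Subtype.ext_iff] using hab)
    fun a => measurableSet_singleton _]
  simp only [Measure.restrict_singleton]

/-! ### Point masses -/

/-- Dominated convergence: `(1 - r)/2` times the Poisson kernel is at most 1, equals `(1 + r)/2` at
`a`, and tends to 0 elsewhere. -/
lemma tendsto_mul_re_cauchyTransform (mu : Measure Circle) [IsFiniteMeasure mu] (a : Circle) :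
    Tendsto (fun r : ℝ => (1 - r) / 2 * (cauchyTransform mu (r * a)).re) (𝓝[<] 1)
      (𝓝 (mu.real {a})) := by
  have hmass : mu.real {a} = ∫ w, ({a} : Set Circle).indicator 1 w ∂mu := by
    rw [integral_indicator_one (measurableSet_singleton a)]
  have key : Tendsto (fun r : ℝ => ∫ w, (1 - r) / 2 * radialPoisson r (dist w a) ∂mu) (𝓝[<] 1)
      (𝓝 (∫ w, ({a} : Set Circle).indicator 1 w ∂mu)) := by
    refine tendsto_integral_filter_of_dominated_convergence (fun _ => (1 : ℝ)) ?_ ?_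
      (integrable_const _) (ae_of_all _ fun w => ?_)
    · filter_upwards [eventually_Ioo_left] with r hr
      have := continuous_radialPoisson hr.1 hr.2
      exact Continuous.aestronglyMeasurable (by fun_prop)
    · filter_upwards [eventually_Ioo_left] with r hr
      refine ae_of_all _ fun w => ?_
      have h1 : 0 < 1 - r := sub_pos.2 hr.2
      have h2 := radialPoisson_nonneg hr.1 hr.2 (dist w a)
      rw [Real.norm_of_nonneg (by positivity), radialPoisson, div_mul_div_comm,
        div_le_one (mul_pos two_pos (radialPoisson_denom_pos hr.1 hr.2 _))]
      have h3 := hr.1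
      have : 0 ≤ r * dist w a ^ 2 := by positivity
      nlinarith [mul_pos (mul_pos h1 h1) h1]
    · by_cases hw : w = a
      · rw [hw, indicator_of_mem (mem_singleton a), dist_self]
        have : Tendsto (fun r : ℝ => (1 + r) / 2) (𝓝[<] 1) (𝓝 ((1 + 1) / 2)) :=
          ((continuous_const.add continuous_id).div_const 2).continuousWithinAt
        norm_num at this
        refine this.congr' ?_
        filter_upwards [eventually_Ioo_left] with r hr
        have h1 : 1 - r ≠ 0 := (sub_pos.2 hr.2).ne'
        rw [radialPoisson]
        field_simp
        ring
      · rw [indicator_of_notMem (by simpa using hw)]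
        have h1 := tendsto_radialPoisson (dist_pos.2 hw)
        have h2 : Tendsto (fun r : ℝ => (1 - r) / 2) (𝓝[<] 1) (𝓝 ((1 - 1) / 2)) :=
          ((continuous_const.sub continuous_id).div_const 2).continuousWithinAt
        simpa using h2.mul h1
  rw [hmass]
  refine key.congr' ?_
  filter_upwards [eventually_Ioo_left] with r hr
  rw [integral_const_mul, re_cauchyTransform mu (norm_ofReal_mul_coe_lt_one hr a)]
  simp only [radialPoisson_eq hr.1.le]

lemma normalizedLebesgue_singleton (a : Circle) : normalizedLebesgue {a} = 0 := by
  have h1 := tendsto_mul_re_cauchyTransform normalizedLebesgue a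
  have h2 : Tendsto (fun r : ℝ => (1 - r) / 2) (𝓝[<] 1) (𝓝 ((1 - 1) / 2)) :=
    ((continuous_const.sub continuous_id).div_const 2).continuousWithinAt
  rw [← measureReal_eq_zero_iff]
  refine tendsto_nhds_unique h1 ?_
  rw [sub_self, zero_div] at h2
  refine h2.congr' ?_
  filter_upwards [eventually_Ioo_left] with r hr
  rw [re_cauchyTransform_normalizedLebesgue (norm_ofReal_mul_coe_lt_one hr a), mul_one]

lemma sin_half_sub_arg_sq (w z : Circle) :
    Real.sin ((Complex.arg (w : ℂ) - Complex.arg (z : ℂ)) / 2) ^ 2 = dist w z ^ 2 / 4 := by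
  set s := (w : ℂ).arg with hs
  set t := (z : ℂ).arg with ht
  have hw : (w : ℂ) = Complex.exp (s * Complex.I) := by
    rw [← Circle.coe_exp, hs, Circle.exp_arg]
  have hz : (z : ℂ) = Complex.exp (t * Complex.I) := by
    rw [← Circle.coe_exp, ht, Circle.exp_arg]
  rw [dist_circle, ← Complex.normSq_eq_norm_sq, hw, hz, Complex.normSq_apply]
  simp only [Complex.sub_re, Complex.sub_im, Complex.exp_ofReal_mul_I_re,
    Complex.exp_ofReal_mul_I_im]
  rw [Real.sin_sq_eq_half_sub, mul_div_cancel₀ _ two_ne_zero, Real.cos_sub]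
  linear_combination (-1 / 4) * Real.sin_sq_add_cos_sq s + (-1 / 4) * Real.sin_sq_add_cos_sq t

lemma atomWeight_eq (lam : Measure Circle) (z : Circle) :
    atomWeight lam z = (∫⁻ w, (ENNReal.ofReal (dist w z ^ 2 / 4))⁻¹ ∂lam)⁻¹ := by
  simp only [atomWeight, sin_half_sub_arg_sq]

/-- If the Poisson integral of `lam` vanishes linearly at `a`, then the integral defining the weight
at `a` converges. -/
lemma lintegral_inv_dist_sq_ne_top {lam : Measure Circle} [IsFiniteMeasure lam] {a : Circle} {K : ℝ}
    (h : ∀ᶠ r : ℝ in 𝓝[<] 1, (cauchyTransform lam (r * a)).re ≤ K * (1 - r)) :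
    ∫⁻ w, (ENNReal.ofReal (dist w a ^ 2 / 4))⁻¹ ∂lam ≠ ⊤ := by
  obtain ⟨u, -, hu1, hu⟩ := exists_seq_strictMono_tendsto' (zero_lt_one (α := ℝ))
  have hu' : Tendsto u atTop (𝓝[<] 1) :=
    tendsto_nhdsWithin_iff.2 ⟨hu, Eventually.of_forall fun n => (hu1 n).2⟩
  -- This is the Poisson kernel divided by `1 - r`, to which Fatou's lemma applies. At `w = a` the
  -- limit is `2 / 0 = ∞`, so an atom of `lam` at `a` is excluded too.
  let f : ℕ → Circle → ENNReal := fun n w =>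
    ENNReal.ofReal (1 + u n) / ENNReal.ofReal ((1 - u n) ^ 2 + u n * dist w a ^ 2)
  have hf : ∀ n, Measurable (f n) := fun n => by
    simp only [f]
    fun_prop
  have hlim : ∀ w, Tendsto (fun n => f n w) atTop
      (𝓝 (ENNReal.ofReal 2 / ENNReal.ofReal (dist w a ^ 2))) := by
    intro w
    have h1 : Tendsto (fun n => ENNReal.ofReal (1 + u n)) atTop (𝓝 (ENNReal.ofReal 2)) := by
      have := ENNReal.tendsto_ofReal (hu.const_add 1)
      rwa [one_add_one_eq_two] at this
    have h2 : Tendsto (fun n => ENNReal.ofReal ((1 - u n) ^ 2 + u n * dist w a ^ 2)) atTop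
        (𝓝 (ENNReal.ofReal (dist w a ^ 2))) := by
      have := ENNReal.tendsto_ofReal (((hu.const_sub 1).pow 2).add (hu.mul_const (dist w a ^ 2)))
      simpa using this
    exact ENNReal.Tendsto.div h1 (Or.inl (by simp)) h2 (Or.inl ENNReal.ofReal_ne_top)
  have hle : ∫⁻ w, ENNReal.ofReal 2 / ENNReal.ofReal (dist w a ^ 2) ∂lam ≤ ENNReal.ofReal K := by
    calc ∫⁻ w, ENNReal.ofReal 2 / ENNReal.ofReal (dist w a ^ 2) ∂lam
        = ∫⁻ w, liminf (fun n => f n w) atTop ∂lam := by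
          simp only [fun w => (hlim w).liminf_eq]
      _ ≤ liminf (fun n => ∫⁻ w, f n w ∂lam) atTop := lintegral_liminf_le hf
      _ ≤ liminf (fun _ => ENNReal.ofReal K) atTop := by
          refine liminf_le_liminf ?_
          filter_upwards [hu'.eventually h] with n hn
          have hr := hu1 n
          have h1 : 0 < 1 - u n := sub_pos.2 hr.2
          have h2 : ∀ w, f n w =
              ENNReal.ofReal (1 - u n)⁻¹ * ENNReal.ofReal (radialPoisson (u n) (dist w a)) := by
            intro w
            rw [← ENNReal.ofReal_mul (inv_nonneg.2 h1.le)]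
            simp only [f]
            rw [← ENNReal.ofReal_div_of_pos (radialPoisson_denom_pos hr.1 hr.2 _), radialPoisson]
            congr 1
            rw [show 1 - u n ^ 2 = (1 - u n) * (1 + u n) by ring, mul_div_assoc,
              inv_mul_cancel_left₀ h1.ne']
          simp only [h2]
          rw [lintegral_const_mul' _ _ ENNReal.ofReal_ne_top,
            ← ofReal_re_cauchyTransform lam hr.1 hr.2, ← ENNReal.ofReal_mul (inv_nonneg.2 h1.le)]
          refine ENNReal.ofReal_le_ofReal ?_
          rw [inv_mul_le_iff₀ h1]
          linarith
      _ = ENNReal.ofReal K := liminf_const _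
  have heq : ∀ w, (ENNReal.ofReal (dist w a ^ 2 / 4))⁻¹ =
      2 * (ENNReal.ofReal 2 / ENNReal.ofReal (dist w a ^ 2)) := by
    intro w
    rw [ENNReal.ofReal_div_of_pos (by norm_num), ENNReal.inv_div (by simp) (by simp),
      ← mul_div_assoc]
    congr 1
    rw [show (4 : ℝ) = 2 * 2 by norm_num, ENNReal.ofReal_mul zero_le_two, ENNReal.ofReal_ofNat]
  simp only [heq]
  rw [lintegral_const_mul' _ _ (by simp)]
  exact ENNReal.mul_ne_top (by simp) (ne_top_of_le_ne_top ENNReal.ofReal_ne_top hle)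

lemma kernel_sub_kernel {u : ℂ} {r : ℝ} (hr : 1 - r ≠ 0) (hu : 1 - u ≠ 0) (hru : 1 - r * u ≠ 0) :
    ((1 + r * u) / (1 - r * u) - (1 + u) / (1 - u)) / (1 - r : ℝ) =
      -2 * u / ((1 - r * u) * (1 - u)) := by
  have : ((1 - r : ℝ) : ℂ) ≠ 0 := Complex.ofReal_ne_zero.2 hr
  push_cast at this ⊢
  field_simp
  ring

/-- Since `1 - r ≤ |1 - ru|`, moving from `ru` to `u` at most doubles the distance to 1. This gives
a dominating function independent of `r`. -/
lemma norm_one_sub_le {u : ℂ} (hu : ‖u‖ = 1) {r : ℝ} (hr : r ∈ Ioo (0 : ℝ) 1) :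
    ‖1 - u‖ ≤ 2 * ‖1 - r * u‖ := by
  have h1 : ‖(1 - r : ℝ) * u‖ = 1 - r := by
    rw [norm_mul, hu, mul_one, Complex.norm_real, Real.norm_of_nonneg (sub_pos.2 hr.2).le]
  have h2 : 1 - r ≤ ‖1 - r * u‖ := by
    have := norm_sub_norm_le (1 : ℂ) (r * u)
    rwa [norm_mul, hu, mul_one, norm_one, Complex.norm_real, Real.norm_of_nonneg hr.1.le] at this
  have h3 : ‖(1 - r * u) - (1 - r : ℝ) * u‖ ≤ _ := norm_sub_le _ _
  have h4 : (1 - r * u) - (1 - r : ℝ) * u = 1 - u := by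
    push_cast
    ring
  rw [h4, h1] at h3
  linarith

/-- Expansion of the Cauchy transform at a boundary point where `∫ |w - a|⁻² dlam` converges. -/
lemma exists_tendsto_div_one_sub {lam : Measure Circle} [IsFiniteMeasure lam] {a : Circle}
    (hint : Integrable (fun w => (dist w a ^ 2)⁻¹) lam) (hne : ∀ᵐ w ∂lam, w ≠ a) :
    ∃ s : ℝ, Tendsto (fun r : ℝ => (cauchyTransform lam (r * a) - s * Complex.I) / (1 - r : ℝ))
      (𝓝[<] 1) (𝓝 (2 * ∫ w, (dist w a ^ 2)⁻¹ ∂lam : ℝ)) := by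
  let v : Circle → ℂ := fun w => ((w⁻¹ : Circle) : ℂ) * a
  have hv : ∀ w, ‖v w‖ = 1 := fun w => by rw [norm_inv_mul, Circle.norm_coe]
  have hvd : ∀ w, ‖1 - v w‖ = dist w a := fun w => by rw [norm_one_sub_eq, dist_circle]
  have hvc : Continuous v := continuous_inv_mul _
  have hv1 : ∀ᵐ w ∂lam, 1 - v w ≠ 0 := by
    filter_upwards [hne] with w hw
    rw [← norm_ne_zero_iff, hvd]
    exact dist_ne_zero.2 hw
  -- The kernel on the boundary itself: purely imaginary because `|v| = 1`, so its integral is `i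
  -- s`, the radial limit of `Q[lam]`.
  let A : Circle → ℂ := fun w => (1 + v w) / (1 - v w)
  have hAm : Measurable A := by
    have := hvc.measurable
    exact (this.const_add 1).div (this.const_sub 1)
  have hAre : ∀ w, (A w).re = 0 := by
    intro w
    have h1 := hv w
    rw [← Real.sqrt_one, Complex.norm_eq_sqrt_sq_add_sq] at h1
    have h2 := Real.sqrt_inj (by positivity) zero_le_one |>.1 h1
    rw [Complex.div_re, ← add_div]
    refine div_eq_zero_iff.2 (Or.inl ?_)
    simp
    linear_combination -h2
  have hAint : Integrable A lam := by
    refine (hint.const_mul 4).mono' hAm.aestronglyMeasurable ?_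
    filter_upwards [hv1] with w hw
    have h0 : 0 < ‖1 - v w‖ := norm_pos_iff.2 hw
    have h1 : ‖1 + v w‖ ≤ 2 := (norm_add_le _ _).trans (by rw [hv, norm_one, one_add_one_eq_two])
    have h2 : ‖1 - v w‖ ≤ 2 := (norm_sub_le _ _).trans (by rw [hv, norm_one, one_add_one_eq_two])
    rw [← hvd, norm_div, ← div_eq_mul_inv, div_le_div_iff₀ h0 (by positivity)]
    nlinarith [mul_nonneg h0.le (norm_nonneg (1 + v w))]
  have hAI : ∫ w, A w ∂lam = ((∫ w, A w ∂lam).im : ℝ) * Complex.I := by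
    have : (∫ w, A w ∂lam).re = 0 := by
      rw [← Complex.reCLM_apply, ← Complex.reCLM.integral_comp_comm hAint]
      simp [hAre]
    conv_lhs => rw [← Complex.re_add_im (∫ w, A w ∂lam), this]
    simp
  refine ⟨(∫ w, A w ∂lam).im, ?_⟩
  rw [← hAI]
  have key : Tendsto (fun r : ℝ => ∫ w, -2 * v w / ((1 - r * v w) * (1 - v w)) ∂lam) (𝓝[<] 1)
      (𝓝 (∫ w, ((2 * (dist w a ^ 2)⁻¹ : ℝ) : ℂ) ∂lam)) := by
    refine tendsto_integral_filter_of_dominated_convergence (fun w => 4 * (dist w a ^ 2)⁻¹) ?_ ?_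
      (hint.const_mul 4) ?_
    · refine Eventually.of_forall fun r => Measurable.aestronglyMeasurable ?_
      have := hvc.measurable
      fun_prop
    · filter_upwards [eventually_Ioo_left] with r hr
      filter_upwards [hv1] with w hw
      have h0 : 0 < ‖1 - v w‖ := norm_pos_iff.2 hw
      have h1 := norm_one_sub_le (hv w) hr
      have h2 : 0 < ‖1 - r * v w‖ := by linarith
      rw [norm_div, norm_mul (-2 : ℂ) (v w), norm_mul (1 - (r : ℂ) * v w), hv, norm_neg,
        Complex.norm_two, mul_one, ← hvd, ← div_eq_mul_inv, div_le_div_iff₀ (mul_pos h2 h0) (by positivity)]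
      nlinarith
    · filter_upwards [hv1] with w hw
      have h0 : ‖1 - v w‖ ≠ 0 := norm_ne_zero_iff.2 hw
      -- For `|v| = 1`, `-2v/(1 - v)² = 2/|1 - v|²`, using `v · conj v = 1`.
      have hval : ((2 * (dist w a ^ 2)⁻¹ : ℝ) : ℂ) =
          -2 * v w / ((1 - (1 : ℝ) * v w) * (1 - v w)) := by
        have h1 : ((dist w a ^ 2 : ℝ) : ℂ) = (1 - v w) * (1 - (starRingEnd ℂ) (v w)) := by
          rw [← hvd, ← Complex.normSq_eq_norm_sq, Complex.normSq_eq_conj_mul_self, mul_comm]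
          simp
        have h2 : v w * (starRingEnd ℂ) (v w) = 1 := by
          rw [Complex.mul_conj, Complex.normSq_eq_norm_sq, hv]
          simp
        have h3 : (1 - v w) * (1 - (starRingEnd ℂ) (v w)) ≠ 0 := by
          rw [← h1, ← hvd]
          exact Complex.ofReal_ne_zero.2 (pow_ne_zero 2 h0)
        rw [Complex.ofReal_mul, Complex.ofReal_inv, h1, Complex.ofReal_one, one_mul,
          ← div_eq_mul_inv, div_eq_div_iff h3 (mul_ne_zero hw hw)]
        push_cast
        linear_combination (-2 * (1 - v w)) * h2
      rw [hval]
      refine Tendsto.div tendsto_const_nhds ?_ ?_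
      · refine (Continuous.tendsto ?_ 1).mono_left nhdsWithin_le_nhds
        fun_prop
      · simpa using hw
  have hJ : ∫ w, ((2 * (dist w a ^ 2)⁻¹ : ℝ) : ℂ) ∂lam =
      (2 * ∫ w, (dist w a ^ 2)⁻¹ ∂lam : ℝ) := by
    rw [← integral_const_mul]
    exact integral_ofReal
  rw [hJ] at key
  refine key.congr' ?_
  filter_upwards [eventually_Ioo_left] with r hr
  have hz := norm_ofReal_mul_coe_lt_one hr a
  have hcomm : ∀ w : Circle, ((w⁻¹ : Circle) : ℂ) * (r * a) = r * v w := fun w =>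
    mul_left_comm _ _ _
  rw [cauchyTransform, ← integral_sub (integrable_of_continuous lam (continuous_kernel hz)) hAint,
    ← integral_div]
  refine integral_congr_ae ?_
  filter_upwards [hv1] with w hw
  have h1 := one_sub_ne_zero w hz
  rw [hcomm] at h1 ⊢
  exact (kernel_sub_kernel (sub_pos.2 hr.2).ne' hw h1).symm

lemma tendsto_ofReal_one_sub : Tendsto (fun r : ℝ => ((1 - r : ℝ) : ℂ)) (𝓝[<] 1) (𝓝 0) := by
  have : Continuous fun r : ℝ => ((1 - r : ℝ) : ℂ) := by fun_prop
  simpa using (this.tendsto 1).mono_left (nhdsWithin_le_nhds (s := Iio 1))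

/-- The mass of the interconverted measure at a zero of `Q_{c₀}[lam]`. -/
lemma IsInterconversion.apply_singleton {lam : Measure Circle} [IsFiniteMeasure lam]
    (hlam : lam ≠ 0) {c₀ : ℝ} {mu : Measure Circle} {ζ₀ : ℝ} (h : IsInterconversion lam c₀ mu ζ₀)
    {a : Circle} (ha : HasHilbertTransformAt lam a (-c₀)) : mu {a} = atomWeight lam a := by
  have := h.finite
  have hmu := tendsto_mul_re_cauchyTransform mu a
  rw [atomWeight_eq]
  by_cases hI : ∫⁻ w, (ENNReal.ofReal (dist w a ^ 2 / 4))⁻¹ ∂lam = ⊤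
  · rw [hI, ENNReal.inv_top, ← measureReal_eq_zero_iff]
    by_contra hne
    have hpos : 0 < mu.real {a} := lt_of_le_of_ne measureReal_nonneg (Ne.symm hne)
    -- A mass `m > 0` gives `Re Q[mu](ra) ≥ m/(1 - r)` near the boundary, hence `Re Q[lam](ra) ≤ (1
    -- - r)/m`.
    refine lintegral_inv_dist_sq_ne_top (K := (mu.real {a})⁻¹) ?_ hI
    filter_upwards [eventually_Ioo_left, hmu.eventually_const_le (half_lt_self hpos)] with r hr h1
    have hz := norm_ofReal_mul_coe_lt_one hr a
    have h2 := re_cauchyTransform_pos mu h.ne_zero hz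
    have h3 : (cauchyTransform lam (r * a)).re ≤ (cauchyTransform mu (r * a)).re⁻¹ := by
      rw [← re_shiftedCauchyTransform lam c₀]
      refine (Complex.re_le_norm _).trans ?_
      rw [← inv_inv (shiftedCauchyTransform lam c₀ _), ← h.eq_inv hz, norm_inv]
      refine inv_anti₀ h2 ?_
      rw [← re_shiftedCauchyTransform mu ζ₀]
      exact Complex.re_le_norm _
    refine h3.trans ?_
    rw [inv_mul_eq_div, inv_le_comm₀ h2 (div_pos (sub_pos.2 hr.2) hpos), inv_div,
      div_le_iff₀ (sub_pos.2 hr.2)]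
    linarith
  -- The integrand is `0⁻¹ = ∞` at `a`, so a finite integral leaves no mass there.
  · have hne : ∀ᵐ w ∂lam, w ≠ a := by
      filter_upwards [ae_lt_top (by fun_prop) hI] with w hw hwa
      simp [hwa] at hw
    have hofReal : ∀ᵐ w ∂lam, (ENNReal.ofReal (dist w a ^ 2 / 4))⁻¹ =
        ENNReal.ofReal (4 * (dist w a ^ 2)⁻¹) := by
      filter_upwards [hne] with w hw
      have := dist_pos.2 hw
      rw [← ENNReal.ofReal_inv_of_pos (by positivity), inv_div, div_eq_mul_inv]
    rw [lintegral_congr_ae hofReal] at hI ⊢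
    have hint4 : Integrable (fun w => 4 * (dist w a ^ 2)⁻¹) lam :=
      ⟨Measurable.aestronglyMeasurable (by fun_prop),
        (hasFiniteIntegral_iff_ofReal (ae_of_all _ fun w => by positivity)).2
          (lt_top_iff_ne_top.2 hI)⟩
    have hint : Integrable (fun w => (dist w a ^ 2)⁻¹) lam := by
      simpa using hint4.const_mul (1 / 4)
    rw [← ofReal_integral_eq_lintegral_ofReal hint4 (ae_of_all _ fun w => by positivity),
      integral_const_mul]
    set J := ∫ w, (dist w a ^ 2)⁻¹ ∂lam with hJ
    have hJpos : 0 < J := by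
      refine (integral_pos_iff_support_of_nonneg (fun w => by positivity) hint).2 ?_
      have : Function.support (fun w => (dist w a ^ 2)⁻¹) =ᵐ[lam] (univ : Set Circle) := by
        refine eventuallyEq_univ.2 ?_
        filter_upwards [hne] with w hw
        have := dist_pos.2 hw
        exact (show (0 : ℝ) < (dist w a ^ 2)⁻¹ by positivity).ne'
      rw [measure_congr this]
      exact Measure.measure_univ_pos.2 hlam
    obtain ⟨s, hs⟩ := exists_tendsto_div_one_sub hint hne
    have hQ : Tendsto (fun r : ℝ => cauchyTransform lam (r * a)) (𝓝[<] 1) (𝓝 (s * Complex.I)) := by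
      have h1 := (hs.mul tendsto_ofReal_one_sub).add_const (s * Complex.I)
      rw [mul_zero, zero_add] at h1
      refine h1.congr' ?_
      filter_upwards [eventually_Ioo_left] with r hr
      rw [div_mul_cancel₀ _ (Complex.ofReal_ne_zero.2 (sub_pos.2 hr.2).ne'), sub_add_cancel]
    -- The constant of the expansion is the Hilbert transform at `a`, so it cancels `c₀` and
    -- `Q_{c₀}[lam]` vanishes there to first order.
    have hsc : s = -c₀ := by
      have h1 := (Complex.continuous_im.tendsto _).comp hQ
      have h2 : ((s : ℂ) * Complex.I).im = s := by simp
      rw [h2] at h1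
      exact tendsto_nhds_unique h1 ha
    have h2J : ((2 * J : ℝ) : ℂ) ≠ 0 := Complex.ofReal_ne_zero.2 (by positivity)
    have hlim := ((Complex.continuous_re.tendsto _).comp (hs.inv₀ h2J)).div_const 2
    have hval : mu.real {a} = (4 * J)⁻¹ := by
      have h1 : (((2 * J : ℝ) : ℂ)⁻¹).re / 2 = (4 * J)⁻¹ := by
        rw [← Complex.ofReal_inv, Complex.ofReal_re, div_eq_mul_inv, ← mul_inv]
        ring
      rw [h1] at hlim
      refine tendsto_nhds_unique hmu (hlim.congr' ?_)
      filter_upwards [eventually_Ioo_left] with r hr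
      have hz := norm_ofReal_mul_coe_lt_one hr a
      have h3 : cauchyTransform lam (r * a) - s * Complex.I =
          shiftedCauchyTransform lam c₀ (r * a) := by
        rw [shiftedCauchyTransform, hsc]
        push_cast
        ring
      rw [← re_shiftedCauchyTransform mu ζ₀, h.eq_inv hz, Function.comp_apply, h3, inv_div,
        div_eq_mul_inv ((1 - r : ℝ) : ℂ), Complex.re_ofReal_mul]
      ring
    rw [← ENNReal.ofReal_inv_of_pos (by positivity), ← hval, ofReal_measureReal]

/-! ### Assembly of the decomposition -/

lemma IsInterconversion.eq_withDensity_add_sum {lam : Measure Circle} [IsFiniteMeasure lam]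
    (hlam : lam ≠ 0) {c₀ : ℝ} (hcount : (atomSet lam c₀).Countable) {mu : Measure Circle} {ζ₀ : ℝ}
    (h : IsInterconversion lam c₀ mu ζ₀) :
    mu = normalizedLebesgue.withDensity
        (fun z => ENNReal.ofReal (interconvertedDensity lam c₀ z)) +
      Measure.sum fun a : atomSet lam c₀ =>
        atomWeight lam (a : Circle) • Measure.dirac (a : Circle) := by
  have := h.finite
  have hdec := h.eq_singularPart_add hlam
  have hs := eq_sum_smul_dirac hcount h.ae_mem_atomSet
  -- The absolutely continuous part has no atoms, so the singular part and `mu` have the same point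
  -- masses.
  have hsing : ∀ a : atomSet lam c₀,
      mu.singularPart normalizedLebesgue {(a : Circle)} = atomWeight lam a := by
    intro a
    rw [← h.apply_singleton hlam a.2.2]
    conv_rhs => rw [hdec]
    rw [Measure.add_apply, withDensity_absolutelyContinuous _ _ (normalizedLebesgue_singleton _),
      zero_add]
  simp only [hsing] at hs
  rwa [← hs]

end

end CircleInterconversion

theorem mainTheorem4 (lam : MeasureTheory.Measure Circle) [MeasureTheory.IsFiniteMeasure lam]
    (hlam : lam ≠ 0) (c₀ : ℝ)
    (hdiscrete : ∀ z ∈ CircleInterconversion.candidateSet lam c₀, ∃ ε : ℝ, 0 < ε ∧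
      ∀ z' ∈ CircleInterconversion.candidateSet lam c₀, z' ≠ z → ε < dist z z') :
    (∃! p : MeasureTheory.Measure Circle × ℝ,
      CircleInterconversion.IsInterconversion lam c₀ p.1 p.2) ∧
    (∀ᵐ z ∂CircleInterconversion.normalizedLebesgue,
      CircleInterconversion.HasHilbertTransformAt lam z
        (CircleInterconversion.hilbertTransform lam z)) ∧
    MeasureTheory.Integrable (CircleInterconversion.interconvertedDensity lam c₀)
      CircleInterconversion.normalizedLebesgue ∧
    CircleInterconversion.atomSet lam c₀ ⊆ CircleInterconversion.candidateSet lam c₀ ∧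
    ∀ (mu : MeasureTheory.Measure Circle) (ζ₀ : ℝ),
      CircleInterconversion.IsInterconversion lam c₀ mu ζ₀ →
        mu = CircleInterconversion.normalizedLebesgue.withDensity
              (fun z => ENNReal.ofReal (CircleInterconversion.interconvertedDensity lam c₀ z)) +
            MeasureTheory.Measure.sum
              (fun a : CircleInterconversion.atomSet lam c₀ =>
                CircleInterconversion.atomWeight lam (a : Circle) •
                  MeasureTheory.Measure.dirac (a : Circle)) ∧
        ζ₀ = ((((lam.real Set.univ : ℝ) : ℂ) + Complex.I * (c₀ : ℂ))⁻¹).im := by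
  have hsub := CircleInterconversion.atomSet_subset_candidateSet lam c₀
  have hcount := (CircleInterconversion.countable_of_isolated hdiscrete).mono hsub
  exact ⟨CircleInterconversion.existsUnique_isInterconversion hlam c₀,
    (CircleInterconversion.ae_tendsto_shiftedCauchyTransform hlam c₀).mono fun _ h => h.1,
    CircleInterconversion.integrable_interconvertedDensity hlam c₀, hsub,
    fun _ _ h => ⟨h.eq_withDensity_add_sum hlam hcount, h.shift_eq⟩⟩
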